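/- Let $G$ be a compact Lie group of dimension $n$ and $\alpha$ a strongly continuous ergodic action of $G$ by $*$-automorphisms on a unital $C^*$-algebra $A$ (ergodic: the only $G$-fixed elements are the scalars). Let $\varphi_0$ be the unique $G$-invariant state of $A$ and $\mathscr H_0$ the GNS Hilbert space of $(A,\varphi_0)$. Let $\mathcal A^1$ be the algebra of all $a\in A$ such that $g\mapsto\alpha_g(a)$ is of class $C^1$. Fix a scalar product on the dual $\mathfrak g^*$ of the Lie algebra $\mathfrak g$ of $G$, an orthonormal basis $(\omega_j)$ of $\mathfrak g^*$, and the dual basis $(\partial_j)$ of $\mathfrak g$, with $[\partial_p,\partial_q]=\sum_i c^i_{pq}\partial_i$; write $\partial_j(a)$ for the derivative of $g\mapsto \alpha_g(a)$ at the neutral element in the direction $\partial_j$. Equip $\bigwedge^\bullet\mathfrak g^*$ with the scalar product $\langle v_1\wedge\dots\wedge v_k,w_1\wedge\dots\wedge w_k\rangle=\det(\langle v_i,w_j\rangle)$, forms of different degrees being orthogonal, and put $\mathscr H_k=\mathscr H_0\otimes\bigwedge^k\mathfrak g^*$ and $\mathscr H=\bigoplus_{k=0}^n\mathscr H_k$.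 On $C=\mathcal A^1\otimes\bigwedge^\bullet\mathfrak g^*\subseteq\mathscr H$ let $$d(a\otimes\omega_{i_1}\wedge\dots\wedge\omega_{i_K})=\sum_{j}\partial_j(a)\otimes\omega_j\wedge\omega_{i_1}\wedge\dots\wedge\omega_{i_K}-\tfrac12\sum_{k=1}^K\sum_{p,q}(-1)^{k+1}c^{i_k}_{pq}\,a\otimes\omega_p\wedge\omega_q\wedge\omega_{i_1}\wedge\dots\wedge\widehat{\omega_{i_k}}\wedge\dots\wedge\omega_{i_K}.$$ Let $h\in\mathcal A^1$ be selfadjoint and $u\in[0,1]$, let $K_{u}[a\otimes v]=[a\,e^{(n/2-k)uh}\otimes v]$ for $a\in A$, $v\in\bigwedge^k\mathfrak g^*$, and $d_u=K_ud\,K_{-u}$ on $C$. Denote by $\ker d_u$, $\operatorname{Ran} d_u$ the kernel and range of the closure of $d_u$ in $\mathscr H$, and by $d_{u,k}\colon\mathscr H_k\to\mathscr H_{k+1}$ the closure of the restriction of $d_u$ to $C\cap\mathscr H_k$ (with $d_{u,-1}=0$); write $d$, $d_k$ for the unperturbed operators (case $h=0$). Then: (a) The operators $d$ and $d_u$ on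 $C$ are well defined and closable, as are their restrictions to each degree, and $\overline{\operatorname{Ran}(d_{k-1})}\subseteq\ker(d_k)$ and $\overline{\operatorname{Ran}(d_{u,k-1})}\subseteq\ker(d_{u,k})$ for all $k\ge0$. (b) $K_u$ extends to a bounded linear operator of $\mathscr H$ onto itself with bounded inverse, and $$K_u(\ker d)=\ker d_u,\qquad K_u\big(\overline{\operatorname{Ran} d}\big)=\overline{\operatorname{Ran} d_u}.$$ (c) For every $k\ge 0$, $K_u(\ker d_k)=\ker d_{u,k}$ and $K_u\big(\overline{\operatorname{Ran} d_{k-1}}\big)=\overline{\operatorname{Ran} d_{u,k-1}}$, so that $K_u$ induces a linear isomorphism of reduced cohomology groups $$\ker(d_k)/\overline{\operatorname{Ran}(d_{k-1})}\;\cong\;\ker(d_{u,k})/\overline{\operatorname{Ran}(d_{u,k-1})}.$$ -/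

import Mathlib

open scoped Manifold ContDiff ComplexOrder

noncomputable section

namespace ConformalComplex

section Algebra

variable {n : ℕ}
  {G : Type*} [TopologicalSpace G] [ChartedSpace (EuclideanSpace ℝ (Fin n)) G] [Group G]
  {A : Type*} [CStarAlgebra A]

/-- The subalgebra `𝒜¹` of all `a` such that `g ↦ α_g(a)` is a `C¹` map `G → A`. -/
def C1 (n : ℕ)
    {G : Type*} [TopologicalSpace G] [ChartedSpace (EuclideanSpace ℝ (Fin n)) G] [Group G]
    (α : G →* (A ≃⋆ₐ[ℂ] A)) : Subalgebra ℂ A where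
  carrier := {a | ContMDiff (𝓡 n) 𝓘(ℝ, A) 1 (fun g : G => α g a)}
  mul_mem' {a b} ha hb := by
    have h := (contDiff_mul (𝕜 := ℝ) (𝔸 := A) (n := 1)).contMDiff.comp
      (ContMDiff.prodMk_space ha hb)
    simpa [Function.comp_def] using h
  add_mem' {a b} ha hb := by
    have h := ContMDiff.add ha hb
    simpa [Pi.add_def] using h
  algebraMap_mem' r := by
    have : (fun g : G => α g (algebraMap ℂ A r)) = fun _ => algebraMap ℂ A r := by
      funext g
      exact AlgHomClass.commutes (α g) r
    change ContMDiff (𝓡 n) 𝓘(ℝ, A) 1 (fun g : G => α g (algebraMap ℂ A r))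
    rw [this]
    exact contMDiff_const

/-- `𝒜¹` is stable under the exponential. -/
theorem exp_mem_C1 (α : G →* (A ≃⋆ₐ[ℂ] A)) {a : A} (ha : a ∈ C1 n α) :
    NormedSpace.exp a ∈ C1 n α := by
  change ContMDiff (𝓡 n) 𝓘(ℝ, A) 1 (fun g : G => α g (NormedSpace.exp a))
  have he : ContDiff ℝ 1 (NormedSpace.exp : A → A) :=
    contDiff_iff_contDiffAt.2 fun x => (NormedSpace.exp_analytic (𝕂 := ℝ) x).contDiffAt
  have hα : (fun g : G => α g (NormedSpace.exp a)) = fun g : G => NormedSpace.exp (α g a) := by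
    funext g
    let _ : NormedAlgebra ℚ A := NormedAlgebra.restrictScalars ℚ ℝ A
    exact NormedSpace.map_exp (α g) (StarAlgEquiv.isometry (α g)).continuous a
  rw [hα]
  exact he.contMDiff.comp ha

/-- The infinitesimal generator `∂_X : 𝒜¹ → A`, that is, the derivative at the neutral element, in
the direction `X ∈ 𝔤`, of the map `g ↦ α_g(a)`. -/
def infGen (α : G →* (A ≃⋆ₐ[ℂ] A)) (X : GroupLieAlgebra (𝓡 n) G) : C1 n α →ₗ[ℂ] A where
  toFun a := mfderiv (𝓡 n) 𝓘(ℝ, A) (fun g : G => α g (a : A)) 1 X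
  map_add' a b := by
    have ha := (a.2.mdifferentiableAt (x := 1) one_ne_zero).hasMFDerivAt
    have hb := (b.2.mdifferentiableAt (x := 1) one_ne_zero).hasMFDerivAt
    have h := (ha.add hb).mfderiv
    have e : (fun g : G => α g ((a + b : C1 n α) : A)) =
        (fun g : G => α g (a : A)) + fun g : G => α g (b : A) := by
      funext g; simp
    rw [e, h]
    rfl
  map_smul' c a := by
    have ha := (a.2.mdifferentiableAt (x := 1) one_ne_zero).hasMFDerivAt
    have h := (((c • ContinuousLinearMap.id ℝ A : A →L[ℝ] A).hasMFDerivAt).comp (1 : G) ha).mfderiv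
    have e : (fun g : G => α g ((c • a : C1 n α) : A)) =
        (c • ContinuousLinearMap.id ℝ A : A →L[ℝ] A) ∘ fun g : G => α g (a : A) := by
      funext g; simp
    rw [e, h]
    rfl

/-- The structure constants `c^k_{ij}` of `𝔤` in the basis `b = (∂_j)`:
`[∂_i, ∂_j] = ∑ k, c^k_{ij} ∂_k`. -/
def structConst (b : Module.Basis (Fin n) ℝ (GroupLieAlgebra (𝓡 n) G)) (i j k : Fin n) : ℝ :=
  b.repr ⁅b i, b j⁆ k

end Algebra

section Forms

/-- `Forms n M` stands for `M ⊗ ⋀^• 𝔤^*`. With `(ω_j)` the basis of `𝔤^*` dual to `(∂_j)`, the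
function `η` stands for the form `∑ S, η S ⊗ ω_S`, where
`ω_S = ω_{i_1} ∧ ⋯ ∧ ω_{i_k}` if `S = {i_1 < ⋯ < i_k}`. -/
abbrev Forms (n : ℕ) (M : Type*) : Type _ := Finset (Fin n) → M

variable {n : ℕ} {M : Type*} [AddCommGroup M] [Module ℂ M]

/-- The exterior multiplication `T_j = ω_j ∧ ·`: for `j ∉ S`, one has
`ω_j ∧ ω_S = (-1) ^ #{i ∈ S | i < j} ω_{S ∪ {j}}`, and `ω_j ∧ ω_S = 0` for `j ∈ S`. -/
def wedge (j : Fin n) : Forms n M →ₗ[ℂ] Forms n M where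
  toFun η S := if j ∈ S then (-1 : ℤ) ^ (S.filter (· < j)).card • η (S.erase j) else 0
  map_add' η ζ := by
    funext S; by_cases h : j ∈ S <;> simp [h]
  map_smul' c η := by
    funext S; by_cases h : j ∈ S <;> simp [h, smul_comm c]

/-- The signed removal of the factor `ω_i`: the form `ω_{i_1} ∧ ⋯ ∧ ω_{i_K}`, `i_1 < ⋯ < i_K`, is
sent to `(-1) ^ (k + 1)` times the product of the remaining factors if `i = i_k`, and to `0` if `i`
is none of the indices. -/
def removeFactor (i : Fin n) : Forms n M →ₗ[ℂ] Forms n M where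
  toFun η S := if i ∈ S then 0 else (-1 : ℤ) ^ (S.filter (· < i)).card • η (insert i S)
  map_add' η ζ := by
    funext S; by_cases h : i ∈ S <;> simp [h]
  map_smul' c η := by
    funext S; by_cases h : i ∈ S <;> simp [h, smul_comm c]

end Forms

section Differential

variable {n : ℕ}
  {G : Type*} [TopologicalSpace G] [ChartedSpace (EuclideanSpace ℝ (Fin n)) G] [Group G]
  {A : Type*} [CStarAlgebra A]

/-- The exterior derivative on `𝒜¹ ⊗ ⋀^• 𝔤^*`,
`d (a ⊗ ω_{i_1} ∧ ⋯ ∧ ω_{i_K}) = ∑ j, ∂_j(a) ⊗ ω_j ∧ ω_{i_1} ∧ ⋯ ∧ ω_{i_K}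
  - 1/2 ∑ k, ∑ p q, (-1)^(k+1) c^{i_k}_{pq} a ⊗ ω_p ∧ ω_q ∧ (ω_{i_1} ∧ ⋯ without ω_{i_k})`. -/
def extD (α : G →* (A ≃⋆ₐ[ℂ] A)) (b : Module.Basis (Fin n) ℝ (GroupLieAlgebra (𝓡 n) G)) :
    Forms n (C1 n α) →ₗ[ℂ] Forms n A :=
  (∑ j, wedge j ∘ₗ (infGen α (b j)).compLeft (Finset (Fin n)))
    - (1 / 2 : ℂ) • ∑ i, ∑ p, ∑ q, (structConst b p q i : ℂ) •
        (wedge p ∘ₗ wedge q ∘ₗ removeFactor i ∘ₗ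
          (C1 n α).val.toLinearMap.compLeft (Finset (Fin n)))

/-- The element `e^{(n/2 - k) u h}`. -/
def confFactor (n : ℕ) (h : A) (u : ℝ) (k : ℕ) : A :=
  NormedSpace.exp (((((n : ℝ) / 2 - k) * u : ℝ) : ℂ) • h)

theorem confFactor_mem_C1 (α : G →* (A ≃⋆ₐ[ℂ] A)) (h : C1 n α) (u : ℝ) (k : ℕ) :
    confFactor n (h : A) u k ∈ C1 n α :=
  exp_mem_C1 (n := n) (a := ((((n : ℝ) / 2 - k) * u : ℝ) : ℂ) • (h : A)) α
    ((C1 n α).smul_mem h.2 _)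

/-- `K_u` on `A ⊗ ⋀^• 𝔤^*`: `a ⊗ v ↦ a e^{(n/2 - k) u h} ⊗ v` for `v` of degree `k`. -/
def confK (n : ℕ) (h : A) (u : ℝ) : Forms n A →ₗ[ℂ] Forms n A :=
  LinearMap.pi fun S =>
    LinearMap.mulRight ℂ (confFactor n h u S.card) ∘ₗ LinearMap.proj S

/-- The restriction of `K_u` to the space `𝒜¹ ⊗ ⋀^• 𝔤^*`, which it preserves for `h ∈ 𝒜¹`. -/
def confK1 (α : G →* (A ≃⋆ₐ[ℂ] A)) (h : C1 n α) (u : ℝ) : Forms n (C1 n α) →ₗ[ℂ] Forms n (C1 n α) :=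
  LinearMap.pi fun S =>
    LinearMap.mulRight ℂ
      (⟨confFactor n (h : A) u S.card, confFactor_mem_C1 α h u S.card⟩ : C1 n α) ∘ₗ
        LinearMap.proj S

/-- The perturbed exterior derivative `d_u = K_u d K_{-u}` on `𝒜¹ ⊗ ⋀^• 𝔤^*`. -/
def extDConf (α : G →* (A ≃⋆ₐ[ℂ] A)) (b : Module.Basis (Fin n) ℝ (GroupLieAlgebra (𝓡 n) G))
    (h : C1 n α) (u : ℝ) : Forms n (C1 n α) →ₗ[ℂ] Forms n A :=
  confK n (h : A) u ∘ₗ extD α b ∘ₗ confK1 α h (-u)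

end Differential

section Hilbert

variable {A : Type*} [CStarAlgebra A] [PartialOrder A] [StarOrderedRing A]

/-- The Hilbert space `ℋ = ℋ₀ ⊗ ⋀^• 𝔤^*`, where `ℋ₀` is the GNS space of `φ`, for the scalar product
on `⋀^• 𝔤^*` for which the `ω_S` are orthonormal, that is, the one given on `k`-fold products of
elements of `𝔤^*` by `det ⟨v_i, w_j⟩`, the `ω_j` being orthonormal in `𝔤^*`. -/
abbrev Hil (n : ℕ) (φ : A →ₚ[ℂ] ℂ) : Type _ := PiLp 2 (fun _ : Finset (Fin n) => φ.GNS)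

/-- The class `[η] ∈ ℋ` of a form `η ∈ A ⊗ ⋀^• 𝔤^*`. -/
def cls (n : ℕ) (φ : A →ₚ[ℂ] ℂ) : Forms n A →ₗ[ℂ] Hil n φ :=
  (WithLp.linearEquiv 2 ℂ (Finset (Fin n) → φ.GNS)).symm.toLinearMap ∘ₗ
    ((UniformSpace.Completion.toComplL (𝕜 := ℂ) (E := φ.PreGNS)).toLinearMap ∘ₗ
      φ.toPreGNS.toLinearMap).compLeft (Finset (Fin n))

/-- The space `ℋ_k = ℋ₀ ⊗ ⋀^k 𝔤^*` as a subspace of `ℋ`. -/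
def degreePart (n : ℕ) (φ : A →ₚ[ℂ] ℂ) (k : ℕ) : Submodule ℂ (Hil n φ) where
  carrier := {x | ∀ S, S.card ≠ k → x S = 0}
  add_mem' hx hy S hS := by simp [hx S hS, hy S hS]
  zero_mem' S _ := by simp
  smul_mem' c x hx S hS := by simp [hx S hS]

variable {n : ℕ}
  {G : Type*} [TopologicalSpace G] [ChartedSpace (EuclideanSpace ℝ (Fin n)) G] [Group G]

/-- For a linear map `D` from `𝒜¹ ⊗ ⋀^• 𝔤^*` to `A ⊗ ⋀^• 𝔤^*`, the set of the pairs
`([η], [D η])`. -/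
def formGraph (φ : A →ₚ[ℂ] ℂ) {α : G →* (A ≃⋆ₐ[ℂ] A)} (D : Forms n (C1 n α) →ₗ[ℂ] Forms n A) :
    Submodule ℂ (Hil n φ × Hil n φ) :=
  LinearMap.range
    ((cls n φ ∘ₗ (C1 n α).val.toLinearMap.compLeft (Finset (Fin n))).prod (cls n φ ∘ₗ D))

/-- The unbounded operator `[η] ↦ [D η]` on `ℋ`, with domain `C = 𝒜¹ ⊗ ⋀^• 𝔤^*`. -/
def coreOp (φ : A →ₚ[ℂ] ℂ) {α : G →* (A ≃⋆ₐ[ℂ] A)} (D : Forms n (C1 n α) →ₗ[ℂ] Forms n A) :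
    Hil n φ →ₗ.[ℂ] Hil n φ :=
  (formGraph φ D).toLinearPMap

/-- The restriction of `coreOp φ D` to the elements of degree `k` of its domain. -/
def coreOpDeg (φ : A →ₚ[ℂ] ℂ) {α : G →* (A ≃⋆ₐ[ℂ] A)} (D : Forms n (C1 n α) →ₗ[ℂ] Forms n A)
    (k : ℕ) : Hil n φ →ₗ.[ℂ] Hil n φ :=
  (coreOp φ D).domRestrict (degreePart n φ k)

end Hilbert

section Cohomology

variable {V : Type*} [AddCommGroup V] [Module ℂ V]

/-- The kernel of an unbounded operator, as a subspace of the ambient space. -/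
def opKer (T : V →ₗ.[ℂ] V) : Submodule ℂ V := (LinearMap.ker T.toFun).map T.domain.subtype

/-- The range of an unbounded operator. -/
def opRange (T : V →ₗ.[ℂ] V) : Submodule ℂ V := LinearMap.range T.toFun

variable {A : Type*} [CStarAlgebra A] [PartialOrder A] [StarOrderedRing A] {n : ℕ}
  {G : Type*} [TopologicalSpace G] [ChartedSpace (EuclideanSpace ℝ (Fin n)) G] [Group G]
  (φ : A →ₚ[ℂ] ℂ) {α : G →* (A ≃⋆ₐ[ℂ] A)} (D : Forms n (C1 n α) →ₗ[ℂ] Forms n A)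

/-- The kernel of the closed operator `D_k : ℋ_k → ℋ_{k+1}`, the closure of the restriction of `D`
to forms of degree `k`. -/
def cocycles (k : ℕ) : Submodule ℂ (Hil n φ) := opKer (coreOpDeg φ D k).closure

/-- The closure of the range of the closed operator `D_{k-1} : ℋ_{k-1} → ℋ_k`, where `D_{-1} = 0`. -/
def closedCoboundaries : ℕ → Submodule ℂ (Hil n φ)
  | 0 => ⊥
  | k + 1 => (opRange (coreOpDeg φ D k).closure).topologicalClosure

/-- The reduced cohomology `H^k = ker(D_k) / closure(Ran(D_{k-1}))`. -/
abbrev RedCohom (k : ℕ) : Type _ :=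
  cocycles φ D k ⧸ (closedCoboundaries φ D k).submoduleOf (cocycles φ D k)

end Cohomology

end ConformalComplex

end

open ConformalComplex

noncomputable section

namespace ConformalComplex

open MeasureTheory Filter Topology

/-! Everything rests on two facts: the invariant state is a trace, so that right multiplication,
hence `K_u`, is bounded on the GNS space; and `K_u × K_u` carries the graph of `d` onto the graph of
`d_u`, so that closures, kernels, ranges and cohomology are transported by a homeomorphism
(`Intertwines`).

Trace property (`rsq_eq_lsq`). Write `ρ = φ(xx⋆)` and `σ = φ(x⋆x)` for a `C¹` element `x`. By
ergodicity the Haar average of an orbit is a scalar, so averaging over `h` the squared seminorms of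
`z α_h(x)` multiplies the right one by `ρ` and the left one by `σ`. A crude inequality between the
two seminorms, whose constant is the measure of a set `B` of group elements, is amplified by `K`
such factors to `μ(B) ρ^K ≤ 4 σ^K`, provided that `B` moves the orbit of `x` by at most a constant
times `1/K`. As the orbit map is `C¹`, the set of all such elements has measure at least `c K⁻ⁿ`.
Polynomial decay cannot be beaten by `(σ/ρ)^K` unless `ρ ≤ σ`. Density of the `C¹` elements and
passage to adjoints give equality.

Closability. The generators are ⋆-derivations annihilated by `φ`, so they have formal adjoints on
the dense space of `C¹` elements (`map_star_mul_infGen`), and so does `d`.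

Inclusion of ranges in kernels. A `C¹` form cannot be differentiated twice, so `d² = 0` makes no
sense on the core. For smooth `f` on `G`, the elements `∫ f(g⁻¹) α_g(a) dg` turn the generators into
left-invariant derivations of `f`. On forms with coefficients in `C^∞(G)` the algebraic identity
`chevalleyEilenberg_sq` applies, so `d` of a smeared form is again in the core and is closed.
Smearing with approximate identities approximates a `C¹` form together with its derivatives, and
closedness of the kernel finishes the argument. The inclusion for `d_u` is the image under `K_u` of
the one for `d`. -/

/-- A positive functional on a C⋆-algebra as a continuous linear map. -/
def posCLM {A : Type*} [CStarAlgebra A] [PartialOrder A] [StarOrderedRing A] (φ : A →ₚ[ℂ] ℂ) :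
    A →L[ℂ] ℂ :=
  ⟨φ.toLinearMap, map_continuous φ⟩

@[simp] theorem posCLM_apply {A : Type*} [CStarAlgebra A] [PartialOrder A] [StarOrderedRing A]
    (φ : A →ₚ[ℂ] ℂ) (a : A) : posCLM φ a = φ a := rfl

/-! ### Averages over a compact group -/

section Averages

variable {G : Type*} [TopologicalSpace G] [Group G]
  {A : Type*} [CStarAlgebra A]

/-- A strongly continuous action by automorphisms of a C⋆-algebra is jointly continuous. -/
theorem continuous_action_uncurry {α : G →* (A ≃⋆ₐ[ℂ] A)} (hα : ∀ a : A, Continuous fun g => α g a) :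
    Continuous fun p : A × G => α p.2 p.1 :=
  continuous_prod_of_continuous_lipschitzWith (fun p : A × G => α p.2 p.1) 1
    hα fun g => (StarAlgEquiv.isometry (α g)).lipschitz

theorem Continuous.action {X : Type*} [TopologicalSpace X] {α : G →* (A ≃⋆ₐ[ℂ] A)}
    (hα : ∀ a : A, Continuous fun g => α g a) {f : X → A} {k : X → G}
    (hk : Continuous k) (hf : Continuous f) : Continuous fun x => α (k x) (f x) :=
  (continuous_action_uncurry hα).comp (hf.prodMk hk)

/-- An automorphism of a C⋆-algebra as a continuous linear map. -/
def autCLM (θ : A ≃⋆ₐ[ℂ] A) : A →L[ℂ] A :=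
  ⟨(θ : A →ₐ[ℂ] A).toLinearMap, (StarAlgEquiv.isometry θ).continuous⟩

@[simp] theorem autCLM_apply (θ : A ≃⋆ₐ[ℂ] A) (a : A) : autCLM θ a = θ a := rfl

theorem integrable_of_continuous_compact {X E : Type*} [TopologicalSpace X] [CompactSpace X]
    [MeasurableSpace X] [BorelSpace X] [NormedAddCommGroup E] {μ : Measure X}
    [IsFiniteMeasure μ] {f : X → E} (hf : Continuous f) : Integrable f μ :=
  hf.integrable_of_hasCompactSupport (HasCompactSupport.of_compactSpace f)

/-- A compact group carries a bi-invariant probability measure. -/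
theorem exists_bi_invariant_probability (G : Type*) [TopologicalSpace G] [Group G]
    [IsTopologicalGroup G] [CompactSpace G] [MeasurableSpace G] [BorelSpace G] :
    ∃ μ : Measure G, IsProbabilityMeasure μ ∧ μ.IsHaarMeasure ∧ μ.IsInvInvariant := by
  let μ : Measure G := Measure.haarMeasure ⊤
  have hp : IsProbabilityMeasure μ :=
    ⟨by simpa using Measure.haarMeasure_self (G := G) (K₀ := ⊤)⟩
  have hμ : μ.IsHaarMeasure := inferInstanceAs (Measure.haarMeasure _).IsHaarMeasure
  -- A right translate of `μ`, and then its image under inversion, is again a Haar probability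
  -- measure; both equal `μ` by uniqueness.
  have hr : μ.IsMulRightInvariant := by
    refine ⟨fun g => ?_⟩
    have h1 : IsProbabilityMeasure (μ.map (· * g)) :=
      Measure.isProbabilityMeasure_map (measurable_mul_const g).aemeasurable
    exact Measure.isHaarMeasure_eq_of_isProbabilityMeasure _ _
  refine ⟨μ, hp, hμ, ⟨?_⟩⟩
  have h1 : IsProbabilityMeasure μ.inv :=
    Measure.isProbabilityMeasure_map measurable_inv.aemeasurable
  have h2 : μ.inv.IsHaarMeasure := Measure.isHaarMeasure_of_isCompact_nonempty_interior _ Set.univ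
    isCompact_univ (by simp) (by simp) (by simp)
  exact Measure.isHaarMeasure_eq_of_isProbabilityMeasure _ _

variable [IsTopologicalGroup G] [CompactSpace G] [MeasurableSpace G] [BorelSpace G]
  {μ : Measure G} [IsProbabilityMeasure μ] [PartialOrder A] [StarOrderedRing A]

/-- The average of an element under an ergodic action is its value under the invariant state. -/
theorem integral_action_eq [μ.IsMulLeftInvariant] {α : G →* (A ≃⋆ₐ[ℂ] A)}
    (hα : ∀ a : A, Continuous fun g => α g a)
    (herg : ∀ a : A, (∀ g : G, α g a = a) → ∃ c : ℂ, a = c • (1 : A))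
    {φ : A →ₚ[ℂ] ℂ} (hφ : φ 1 = 1) (hinv : ∀ (g : G) (a : A), φ (α g a) = φ a) (a : A) :
    ∫ g, α g a ∂μ = φ a • (1 : A) := by
  have hint := integrable_of_continuous_compact (μ := μ) (hα a)
  -- The average is fixed by the action, hence a scalar; applying `φ` under the integral identifies
  -- it.
  obtain ⟨c, hc⟩ := herg (∫ g, α g a ∂μ) fun h => by
    have := (autCLM (α h)).integral_comp_comm hint
    simp only [autCLM_apply] at this
    rw [← this]
    have h2 := integral_mul_left_eq_self (μ := μ) (fun g => α g a) h
    simpa using h2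
  have h1 : φ (∫ g, α g a ∂μ) = φ a := by
    have := (posCLM φ).integral_comp_comm hint
    simp only [posCLM_apply] at this
    rw [← this]
    simp [hinv]
  rw [hc] at h1 ⊢
  rw [← h1]
  simp [hφ]

end Averages

/-! ### The left and right seminorms of a positive functional -/

section Squares

variable {A : Type*} [CStarAlgebra A] [PartialOrder A] [StarOrderedRing A] (φ : A →ₚ[ℂ] ℂ)

/-- The real part of a positive functional, as a continuous real-linear functional. -/
def reCLM : A →L[ℝ] ℝ := Complex.reCLM.comp ((posCLM φ).restrictScalars ℝ)

@[simp] theorem reCLM_apply (a : A) : reCLM φ a = (φ a).re := rfl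

theorem reCLM_mono {a b : A} (h : a ≤ b) : reCLM φ a ≤ reCLM φ b :=
  (Complex.le_def.1 (OrderHomClass.mono φ h)).1

theorem reCLM_nonneg {a : A} (h : 0 ≤ a) : 0 ≤ reCLM φ a := by
  simpa using reCLM_mono φ h

theorem ofReal_reCLM {a : A} (h : 0 ≤ a) : ((reCLM φ a : ℝ) : ℂ) = φ a := by
  have := (Complex.le_def.1 (φ.map_nonneg h)).2
  apply Complex.ext <;> simp_all

/-- The square `φ(a a⋆)` of the right seminorm of `φ`. -/
def rsq (a : A) : ℝ := reCLM φ (a * star a)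

/-- The square `φ(a⋆ a)` of the left seminorm of `φ`. -/
def lsq (a : A) : ℝ := reCLM φ (star a * a)

theorem rsq_nonneg (a : A) : 0 ≤ rsq φ a := reCLM_nonneg φ (mul_star_self_nonneg a)

theorem lsq_nonneg (a : A) : 0 ≤ lsq φ a := reCLM_nonneg φ (star_mul_self_nonneg a)

theorem lsq_star (a : A) : lsq φ (star a) = rsq φ a := by simp [lsq, rsq]

theorem continuous_rsq : Continuous (rsq φ) := by unfold rsq; fun_prop

theorem continuous_lsq : Continuous (lsq φ) := by unfold lsq; fun_prop

/-- Since `a b b⋆ a⋆ ≤ ‖b‖² a a⋆`, right multiplication is always bounded for the right seminorm.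
The GNS norm is the left one, which is why the trace property is needed. -/
theorem rsq_mul_le (a b : A) : rsq φ (a * b) ≤ ‖b‖ ^ 2 * rsq φ a := by
  have h : (a * b) * star (a * b) ≤ ‖b * star b‖ • (a * star a) := by
    have := CStarAlgebra.star_right_conjugate_le_norm_smul (a := a) (b := b * star b)
    simpa [mul_assoc] using this
  have := reCLM_mono φ h
  rwa [map_smul, CStarRing.norm_self_mul_star, ← sq, smul_eq_mul] at this

/-- Positivity of `φ((ta - b)(ta - b)⋆)`, divided by `t`, bounds the cross terms. -/
theorem rsq_add_le {t : ℝ} (ht : 0 < t) (a b : A) :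
    rsq φ (a + b) ≤ (1 + t) * rsq φ a + (1 + 1 / t) * rsq φ b := by
  have h := rsq_nonneg φ (t • a - b)
  have e : rsq φ (a + b) = rsq φ a + rsq φ b + reCLM φ (a * star b + b * star a) := by
    simp only [rsq, ← map_add]; congr 1; simp [add_mul, mul_add]; abel
  have e' : rsq φ (t • a - b) = t ^ 2 * rsq φ a + rsq φ b - t * reCLM φ (a * star b + b * star a) := by
    have : (t • a - b) * star (t • a - b) =
        t ^ 2 • (a * star a) + b * star b - t • (a * star b + b * star a) := by
      simp only [sub_mul, mul_sub, star_sub, star_smul, star_trivial, smul_mul_assoc, mul_smul_comm]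
      module
    simp only [rsq, this, map_sub, map_add, map_smul, smul_eq_mul]
  rw [e, ← sub_nonneg]
  rw [e'] at h
  have : (1 + t) * rsq φ a + (1 + 1 / t) * rsq φ b -
      (rsq φ a + rsq φ b + reCLM φ (a * star b + b * star a)) =
      (t ^ 2 * rsq φ a + rsq φ b - t * reCLM φ (a * star b + b * star a)) / t := by
    field_simp; ring
  rw [this]
  positivity

end Squares

section Action

variable {G : Type*} [Group G] {A : Type*} [CStarAlgebra A] {α : G →* (A ≃⋆ₐ[ℂ] A)}

theorem action_action_inv (g : G) (a : A) : α g (α g⁻¹ a) = a := by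
  rw [← StarAlgEquiv.mul_apply, ← map_mul]; simp

variable [PartialOrder A] [StarOrderedRing A] {φ : A →ₚ[ℂ] ℂ}

theorem rsq_action (hinv : ∀ (g : G) (a : A), φ (α g a) = φ a) (g : G) (a : A) :
    rsq φ (α g a) = rsq φ a := by
  simp [rsq, ← map_star, ← map_mul, hinv]

theorem lsq_action (hinv : ∀ (g : G) (a : A), φ (α g a) = φ a) (g : G) (a : A) :
    lsq φ (α g a) = lsq φ a := by
  simp [lsq, ← map_star, ← map_mul, hinv]

end Action

/-! ### Operator-valued Cauchy–Schwarz -/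

section CauchySchwarz

variable {X : Type*} [TopologicalSpace X] [CompactSpace X] [MeasurableSpace X] [BorelSpace X]
  {A : Type*} [CStarAlgebra A] [PartialOrder A] [StarOrderedRing A]

/-- Operator-valued Cauchy–Schwarz inequality. -/
theorem star_integral_mul_integral_le (ν : Measure X) [IsFiniteMeasure ν] {F : X → A}
    (hF : Continuous F) :
    star (∫ x, F x ∂ν) * ∫ x, F x ∂ν ≤ ν.real Set.univ • ∫ x, star (F x) * F x ∂ν := by
  set y := ∫ x, F x ∂ν with hy
  set M := ν.real Set.univ with hM
  rcases eq_or_lt_of_le (measureReal_nonneg : 0 ≤ M) with h0 | h0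
  · have : ν = 0 := by simpa [hM, Measure.real, ENNReal.toReal_eq_zero_iff] using h0.symm
    simp [hy, this]
  have hi {K : X → A} (hK : Continuous K) : Integrable K ν := integrable_of_continuous_compact hK
  -- Expanding the integral of `|M F - y|²` gives `M` times the required difference.
  have h1 : 0 ≤ ∫ x, star (M • F x - y) * (M • F x - y) ∂ν :=
    integral_nonneg fun x => star_mul_self_nonneg _
  have e1 : ∫ x, star (F x) * y ∂ν = star y * y := by
    have h2 := ((ContinuousLinearMap.mul ℝ A).flip y).integral_comp_comm
      (hi (K := fun x => star (F x)) (by fun_prop))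
    have h3 := (starL' ℝ : A ≃L[ℝ] A).integral_comp_comm F (μ := ν)
    simp only [ContinuousLinearMap.flip_apply, ContinuousLinearMap.mul_apply', starL'_apply] at h2 h3
    rw [h2, h3]
  have e2 : ∫ x, star y * F x ∂ν = star y * y :=
    (ContinuousLinearMap.mul ℝ A (star y)).integral_comp_comm (hi hF)
  have e : ∫ x, star (M • F x - y) * (M • F x - y) ∂ν =
      M • (M • (∫ x, star (F x) * F x ∂ν) - star y * y) := by
    have (x : X) : star (M • F x - y) * (M • F x - y) =
        (M ^ 2) • (star (F x) * F x) - M • (star (F x) * y) - M • (star y * F x) + star y * y := by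
      simp only [sub_mul, mul_sub, star_sub, star_smul, star_trivial, smul_mul_assoc, mul_smul_comm]
      module
    simp_rw [this]
    rw [integral_add, integral_sub, integral_sub, integral_smul, integral_smul, integral_smul,
      e1, e2, integral_const, ← hM]
    · module
    all_goals exact hi (by fun_prop)
  rw [e] at h1
  rw [← sub_nonneg]
  have h2 := smul_nonneg (inv_nonneg.2 h0.le) h1
  rwa [inv_smul_smul₀ h0.ne'] at h2

theorem rsq_integral_le (φ : A →ₚ[ℂ] ℂ) (ν : Measure X) [IsFiniteMeasure ν] {F : X → A}
    (hF : Continuous F) :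
    rsq φ (∫ x, F x ∂ν) ≤ ν.real Set.univ * ∫ x, rsq φ (F x) ∂ν := by
  have h := reCLM_mono φ (star_integral_mul_integral_le ν hF.star)
  have h3 := (starL' ℝ : A ≃L[ℝ] A).integral_comp_comm F (μ := ν)
  simp only [starL'_apply] at h3
  rw [h3, map_smul, smul_eq_mul, ← (reCLM φ).integral_comp_comm] at h
  · simpa [rsq] using h
  · exact integrable_of_continuous_compact (by fun_prop)

end CauchySchwarz

/-! ### Comparing the two seminorms up to a volume factor -/

section Trace

variable {G : Type*} [TopologicalSpace G] [Group G] [CompactSpace G]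
  [MeasurableSpace G] [BorelSpace G]
  {A : Type*} [CStarAlgebra A] [PartialOrder A] [StarOrderedRing A]
  {μ : Measure G} [IsProbabilityMeasure μ]
  {α : G →* (A ≃⋆ₐ[ℂ] A)} {φ : A →ₚ[ℂ] ℂ}

/-- The variable `h` occurs only in the middle of `z α_h(x x⋆) z⋆`, and the average of `α_h(x x⋆)`
is the scalar `φ(x x⋆)`. -/
theorem integral_rsq_mul_action (hα : ∀ a : A, Continuous fun g => α g a)
    (havg : ∀ a, ∫ g, α g a ∂μ = φ a • (1 : A)) (z x : A) :
    ∫ h, rsq φ (z * α h x) ∂μ = rsq φ x * rsq φ z := by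
  have hint := integrable_of_continuous_compact (μ := μ) (hα (x * star x))
  let L : A →L[ℝ] ℝ := (reCLM φ).comp
    ((ContinuousLinearMap.mul ℝ A z).comp ((ContinuousLinearMap.mul ℝ A).flip (star z)))
  have hL : ∀ a, L a = reCLM φ (z * (a * star z)) := fun a => rfl
  have := L.integral_comp_comm hint
  rw [havg, ← ofReal_reCLM φ (mul_star_self_nonneg x)] at this
  simp only [hL, Complex.coe_smul, smul_mul_assoc, one_mul, mul_smul_comm, map_smul, smul_eq_mul] at this
  rw [rsq, rsq, ← this]
  congr 1
  ext h
  simp only [rsq, star_mul, map_mul, map_star, mul_assoc]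

/-- By invariance of `φ`, apply `α_{h⁻¹}` first: now `z` carries the group variable and `x` is
fixed. Taking adjoints and substituting `h⁻¹` for `h` reduces to the right seminorm. -/
theorem integral_lsq_mul_action [IsTopologicalGroup G] [μ.IsInvInvariant] (hα : ∀ a : A, Continuous fun g => α g a)
    (hinv : ∀ (g : G) (a : A), φ (α g a) = φ a)
    (havg : ∀ a, ∫ g, α g a ∂μ = φ a • (1 : A)) (z x : A) :
    ∫ h, lsq φ (z * α h x) ∂μ = lsq φ z * lsq φ x := by
  have := integral_rsq_mul_action hα havg (star x) (star z)
  rw [← lsq_star, ← lsq_star, star_star, star_star] at this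
  rw [← this, ← integral_inv_eq_self]
  congr 1
  ext h
  rw [← lsq_action hinv h, ← lsq_star, map_mul, action_action_inv, star_mul, map_star,
    star_star, star_star]

/-- The `C⋆`-norm of the integral of an orbit over a set is controlled by the invariant state. -/
theorem rsq_setIntegral_action_le (hα : ∀ a : A, Continuous fun g => α g a) (hφ : φ 1 = 1)
    (havg : ∀ a, ∫ g, α g a ∂μ = φ a • (1 : A)) (B : Set G) (z : A) :
    rsq φ (∫ g in B, α g z ∂μ) ≤ μ.real B * lsq φ z := by
  have h1 := star_integral_mul_integral_le (μ.restrict B) (hα z)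
  set y := ∫ g in B, α g z ∂μ
  -- The integrand is positive, so enlarging `B` to the whole group only increases the integral,
  -- which is then a scalar.
  have h2 : ∫ g in B, star (α g z) * α g z ∂μ ≤ lsq φ z • (1 : A) := by
    have : ∫ g, star (α g z) * α g z ∂μ = lsq φ z • (1 : A) := by
      simp_rw [← map_star, ← map_mul]
      rw [havg, lsq, ← ofReal_reCLM φ (star_mul_self_nonneg z), Complex.coe_smul]
    rw [← this]
    exact integral_mono_measure Measure.restrict_le_self
      (ae_of_all _ fun g => star_mul_self_nonneg _)
      (integrable_of_continuous_compact ((hα z).star.mul (hα z)))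
  have h3 : star y * y ≤ algebraMap ℝ A (μ.real B * lsq φ z) := by
    refine h1.trans ?_
    rw [Algebra.algebraMap_eq_smul_one, mul_smul, measureReal_restrict_apply_univ]
    exact smul_le_smul_of_nonneg_left h2 measureReal_nonneg
  have h4 : ‖y‖ ^ 2 ≤ μ.real B * lsq φ z := by
    rw [sq, ← CStarRing.norm_star_mul_self]
    exact (CStarAlgebra.norm_le_iff_le_algebraMap _
      (mul_nonneg measureReal_nonneg (lsq_nonneg φ z))).2 h3
  have h5 := rsq_mul_le φ 1 y
  have h6 : rsq φ 1 = 1 := by simp [rsq, hφ]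
  rw [one_mul, h6, mul_one] at h5
  exact h5.trans h4

/-- Split `μ(B) z` into the integral of the orbit over `B`, controlled by the left seminorm, and the
integral of the defects `z - α_g(z)`. This is the inequality to be amplified. -/
theorem mul_rsq_le_lsq_add (hα : ∀ a : A, Continuous fun g => α g a) (hφ : φ 1 = 1)
    (havg : ∀ a, ∫ g, α g a ∂μ = φ a • (1 : A)) (B : Set G) (z : A) :
    μ.real B * rsq φ z ≤ 2 * lsq φ z + 2 * ∫ g in B, rsq φ (z - α g z) ∂μ := by
  set M := μ.real B with hM
  rcases eq_or_lt_of_le (measureReal_nonneg : 0 ≤ M) with h0 | h0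
  · rw [hM, ← h0, zero_mul]
    have := lsq_nonneg φ z
    have : 0 ≤ ∫ g in B, rsq φ (z - α g z) ∂μ := integral_nonneg fun g => rsq_nonneg φ _
    positivity
  have e : M • z = (∫ g in B, α g z ∂μ) + ∫ g in B, (z - α g z) ∂μ := by
    rw [integral_sub (integrable_const z) (integrable_of_continuous_compact (hα z)),
      integral_const, measureReal_restrict_apply_univ]
    abel
  have h1 := rsq_add_le φ one_pos (∫ g in B, α g z ∂μ) (∫ g in B, (z - α g z) ∂μ)
  have h2 := rsq_setIntegral_action_le hα hφ havg B z
  have h3 := rsq_integral_le φ (μ.restrict B) (F := fun g => z - α g z)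
    (continuous_const.sub (hα z))
  rw [measureReal_restrict_apply_univ] at h3
  have h4 : rsq φ (M • z) = M * (M * rsq φ z) := by
    simp [rsq, smul_smul]; ring
  rw [← e, h4] at h1
  refine le_of_mul_le_mul_left ?_ h0
  nlinarith

/-- One more factor `α_h(x)` in an inequality between the left and the right seminorm. -/
theorem rsq_le_lsq_add_step [IsTopologicalGroup G] [SecondCountableTopology G] [μ.IsInvInvariant]
    (hα : ∀ a : A, Continuous fun g => α g a) (hinv : ∀ (g : G) (a : A), φ (α g a) = φ a)
    (havg : ∀ a, ∫ g, α g a ∂μ = φ a • (1 : A)) {B : Set G} (hB : MeasurableSet B) {x : A}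
    {ε : ℝ} (hε : ∀ g ∈ B, ∀ h, ‖α g (α h x) - α h x‖ ≤ ε) {p q r t : ℝ} (hr : 0 ≤ r) (ht : 0 < t)
    (H : ∀ z, p * rsq φ z ≤ q * lsq φ z + r * ∫ g in B, rsq φ (z - α g z) ∂μ) (z : A) :
    (p * rsq φ x - r * ((1 + 1 / t) * ε ^ 2 * μ.real B)) * rsq φ z ≤
      q * lsq φ x * lsq φ z + r * ((1 + t) * rsq φ x) * ∫ g in B, rsq φ (z - α g z) ∂μ := by
  have hrs := continuous_rsq φ
  have hls := continuous_lsq φ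
  have hx := hα x
  have hF : Continuous fun p : G × G => rsq φ (z * α p.1 x - α p.2 (z * α p.1 x)) := by
    have h1 : Continuous fun p : G × G => z * α p.1 x := by fun_prop
    exact hrs.comp (h1.sub (Continuous.action hα continuous_snd h1))
  -- The defect of a product obeys a Leibniz rule: a defect of `z` times `α_h(x)`, plus `α_g(z)`
  -- times a defect of the orbit of `x`, of norm at most `ε`. Averaging over `h` turns the first
  -- part into `ρ` times the old defect.
  have h1 : ∫ h, ∫ g in B, rsq φ (z * α h x - α g (z * α h x)) ∂μ ∂μ ≤
      (1 + t) * rsq φ x * (∫ g in B, rsq φ (z - α g z) ∂μ) +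
        (1 + 1 / t) * ε ^ 2 * μ.real B * rsq φ z := by
    rw [integral_integral_swap
      (f := fun h g => rsq φ (z * α h x - α g (z * α h x)))
      (integrable_of_continuous_compact hF)]
    have h2 (g : G) (hg : g ∈ B) : ∫ h, rsq φ (z * α h x - α g (z * α h x)) ∂μ ≤
        (1 + t) * rsq φ x * rsq φ (z - α g z) + (1 + 1 / t) * ε ^ 2 * rsq φ z := by
      have h3 (h : G) : rsq φ (z * α h x - α g (z * α h x)) ≤
          (1 + t) * rsq φ ((z - α g z) * α h x) + (1 + 1 / t) * ε ^ 2 * rsq φ z := by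
        have e : z * α h x - α g (z * α h x) =
            (z - α g z) * α h x + α g z * (α h x - α g (α h x)) := by
          rw [map_mul]; noncomm_ring
        rw [e]
        refine (rsq_add_le φ ht _ _).trans ?_
        gcongr _ + ?_
        rw [mul_assoc]
        gcongr
        refine (rsq_mul_le φ _ _).trans ?_
        rw [rsq_action hinv, norm_sub_rev]
        gcongr
        · exact rsq_nonneg φ z
        · exact hε g hg h
      have hc : Continuous fun h => rsq φ ((z - α g z) * α h x) := by fun_prop
      refine (integral_mono (μ := μ) (integrable_of_continuous_compact ?_)
        (integrable_of_continuous_compact ?_) h3).trans_eq ?_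
      · exact hF.comp (continuous_id.prodMk continuous_const)
      · fun_prop
      rw [integral_add (integrable_of_continuous_compact (by fun_prop)) (integrable_const _),
        integral_const_mul, integral_rsq_mul_action hα havg, integral_const]
      simp; ring
    have hc : Continuous fun g => rsq φ (z - α g z) := hrs.comp (continuous_const.sub (hα z))
    refine (setIntegral_mono_on ?_ ?_ hB h2).trans_eq ?_
    · have := (integrable_of_continuous_compact (μ := μ.prod μ) hF).swap.integral_prod_left
      exact this.integrableOn
    · exact (integrable_of_continuous_compact (by fun_prop)).integrableOn
    rw [integral_add (integrable_of_continuous_compact (by fun_prop)) (integrable_const _),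
        integral_const_mul, integral_const, measureReal_restrict_apply_univ]
    simp; ring
  have hQ : Continuous fun h => ∫ g in B, rsq φ (z * α h x - α g (z * α h x)) ∂μ := by
    simpa using continuous_parametric_integral_of_continuous (μ := μ.restrict B)
      (f := fun h g => rsq φ (z * α h x - α g (z * α h x))) hF isCompact_univ
  -- Apply `H` to `z α_h(x)` and average over `h`.
  have h5 : ∫ h, p * rsq φ (z * α h x) ∂μ ≤ ∫ h, (q * lsq φ (z * α h x) +
      r * ∫ g in B, rsq φ (z * α h x - α g (z * α h x)) ∂μ) ∂μ := by
    refine integral_mono (integrable_of_continuous_compact (by fun_prop))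
      (integrable_of_continuous_compact (by fun_prop)) fun h => H _
  rw [integral_add (integrable_of_continuous_compact (by fun_prop))
    (integrable_of_continuous_compact (by fun_prop)), integral_const_mul, integral_const_mul,
    integral_const_mul, integral_rsq_mul_action hα havg, integral_lsq_mul_action hα hinv havg] at h5
  have := mul_le_mul_of_nonneg_left h1 hr
  linarith

/-- An inequality between the seminorms of the `K`-th powers, up to the inverse of the measure of a
set of group elements that almost fix the orbit of `x`. -/
theorem measure_mul_rsq_pow_le [IsTopologicalGroup G] [SecondCountableTopology G]
    [μ.IsInvInvariant]
    (hα : ∀ a : A, Continuous fun g => α g a) (hφ : φ 1 = 1)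
    (hinv : ∀ (g : G) (a : A), φ (α g a) = φ a)
    (havg : ∀ a, ∫ g, α g a ∂μ = φ a • (1 : A)) {B : Set G} (hB : MeasurableSet B) {x : A}
    {ε : ℝ} (hε : ∀ g ∈ B, ∀ h, ‖α g (α h x) - α h x‖ ≤ ε) {K : ℕ} (hK : 0 < K)
    (hεx : 25 * K ^ 2 * ε ^ 2 ≤ rsq φ x) :
    μ.real B * rsq φ x ^ K ≤ 4 * lsq φ x ^ K := by
  set M := μ.real B with hM
  set ρ := rsq φ x with hρ
  have hρ0 : 0 ≤ ρ := rsq_nonneg φ x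
  have hM0 : 0 ≤ M := measureReal_nonneg
  have hK' : (1 : ℝ) ≤ K := by exact_mod_cast hK
  have ht : (0 : ℝ) < 1 / K := by positivity
  -- With this `t` the accumulated factor `(1 + t)^K` stays below `e`, while `1 + 1/t ≤ 2K`.
  set t : ℝ := 1 / K with htdef
  -- Each of the `j` steps costs on the left at most a relative amount `(1 + t)^j * 4K / (25K²)`:
  -- the factor `2` of the defect term, times `1 + 1/t ≤ 2K`, times `ε² ≤ ρ / (25K²)`.
  have key (j : ℕ) : ∀ z, (M * ρ ^ j * (1 - j * ((1 + t) ^ j * (4 * K / (25 * K ^ 2))))) * rsq φ z ≤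
      2 * lsq φ x ^ j * lsq φ z + 2 * ((1 + t) * ρ) ^ j * ∫ g in B, rsq φ (z - α g z) ∂μ := by
    induction j with
    | zero => simpa using fun z => mul_rsq_le_lsq_add hα hφ havg B z
    | succ j ih =>
      intro z
      have h := rsq_le_lsq_add_step hα hinv havg hB hε (by positivity) ht ih z
      have e1 : 2 * lsq φ x ^ j * lsq φ x * lsq φ z = 2 * lsq φ x ^ (j + 1) * lsq φ z := by ring
      have e2 : 2 * ((1 + t) * ρ) ^ j * ((1 + t) * rsq φ x) = 2 * ((1 + t) * ρ) ^ (j + 1) := by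
        rw [← hρ]; ring
      rw [e1, e2] at h
      refine le_trans (mul_le_mul_of_nonneg_right ?_ (rsq_nonneg φ z)) h
      have h1 : (1 + 1 / t) * ε ^ 2 ≤ 2 * K / (25 * K ^ 2) * ρ := by
        rw [div_mul_eq_mul_div, le_div_iff₀ (by positivity)]
        have : 1 + 1 / t ≤ 2 * K := by rw [htdef]; simp; linarith
        calc (1 + 1 / t) * ε ^ 2 * (25 * K ^ 2) = (1 + 1 / t) * (25 * K ^ 2 * ε ^ 2) := by ring
          _ ≤ 2 * K * ρ := by gcongr
      have h2 : 2 * ((1 + t) * ρ) ^ j * ((1 + 1 / t) * ε ^ 2 * M) ≤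
          2 * ((1 + t) * ρ) ^ j * (2 * K / (25 * K ^ 2) * ρ * M) := by gcongr
      have h3 : (1 + t) ^ j ≤ (1 + t) ^ (j + 1) := pow_le_pow_right₀ (by linarith) (by omega)
      have h4 : (0 : ℝ) ≤ M * ρ ^ (j + 1) * (4 * K / (25 * K ^ 2)) * (j + 1) := by positivity
      have h5 := mul_le_mul_of_nonneg_left h3 h4
      push_cast
      calc M * ρ ^ (j + 1) * (1 - (j + 1) * ((1 + t) ^ (j + 1) * (4 * K / (25 * K ^ 2))))
          ≤ M * ρ ^ (j + 1) * (1 - (j + 1) * ((1 + t) ^ j * (4 * K / (25 * K ^ 2)))) := by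
            linarith
        _ = M * ρ ^ j * (1 - j * ((1 + t) ^ j * (4 * K / (25 * K ^ 2)))) * ρ -
            2 * ((1 + t) * ρ) ^ j * (2 * K / (25 * K ^ 2) * ρ * M) := by
            rw [mul_pow]; ring
        _ ≤ _ := by linarith
  -- The unit is fixed by the action, so at `z = 1` the defect term vanishes.
  have h1 := key K 1
  have h2 : (1 + t) ^ K ≤ 3 := by
    calc (1 + t) ^ K ≤ Real.exp t ^ K := by
          gcongr
          linarith [Real.add_one_le_exp t]
      _ = Real.exp 1 := by rw [← Real.exp_nat_mul, htdef]; congr 1; field_simp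
      _ ≤ 3 := Real.exp_one_lt_three.le
  -- The total relative loss is at most `3 * 4/25 = 12/25`, so at least half of the left side
  -- survives; this is what the constant `25` is for.
  have h3 : (1 : ℝ) / 2 ≤ 1 - K * ((1 + t) ^ K * (4 * K / (25 * K ^ 2))) := by
    have : K * ((1 + t) ^ K * (4 * K / (25 * K ^ 2))) = (1 + t) ^ K * (4 / 25) := by field_simp
    rw [this]; linarith
  have h4 := mul_le_mul_of_nonneg_left h3 (mul_nonneg hM0 (pow_nonneg hρ0 K))
  simp [rsq, lsq, hφ] at h1
  simp only [rsq, lsq, reCLM_apply] at h4 hρ ⊢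
  linarith

end Trace

/-! ### Box counting and Lipschitz bounds in charts -/

section Volume

/-- If finitely many cells cover `U` and elements of the same cell differ by an element of `B`,
then `U` has measure at most the number of cells times the measure of `B`. -/
theorem measureReal_le_card_mul {G ι : Type*} [Group G] [MeasurableSpace G] [MeasurableMul G]
    {μ : Measure G} [IsFiniteMeasure μ] [μ.IsMulLeftInvariant] {U B : Set G} (T : Finset ι)
    (cell : G → ι) (hT : ∀ g ∈ U, cell g ∈ T)
    (hB : ∀ g ∈ U, ∀ g' ∈ U, cell g = cell g' → g'⁻¹ * g ∈ B) :
    μ.real U ≤ T.card * μ.real B := by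
  have h1 : U ⊆ ⋃ i ∈ T, (U ∩ cell ⁻¹' {i}) := fun g hg => by
    simpa using ⟨hg, hT g hg⟩
  have h2 (i : ι) : μ (U ∩ cell ⁻¹' {i}) ≤ μ B := by
    -- A nonempty cell containing `g'` lies in the translate `g' B`, which has the measure of `B`.
    rcases (U ∩ cell ⁻¹' {i}).eq_empty_or_nonempty with h | ⟨g', hg', hi⟩
    · simp [h]
    · rw [← measure_preimage_mul μ g'⁻¹ B]
      refine measure_mono fun g hg => hB g hg.1 g' hg' ?_
      rw [hg.2, hi]
  have h3 : μ U ≤ T.card * μ B := by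
    calc μ U ≤ ∑ i ∈ T, μ (U ∩ cell ⁻¹' {i}) := (measure_mono h1).trans (measure_biUnion_finset_le _ _)
      _ ≤ ∑ i ∈ T, μ B := Finset.sum_le_sum fun i _ => h2 i
      _ = _ := by simp
  have := ENNReal.toReal_mono (by finiteness) h3
  simpa [Measure.real] using this

theorem EuclideanSpace.norm_le_card_mul {n : ℕ} {v : EuclideanSpace ℝ (Fin n)} {r : ℝ}
    (h : ∀ i, |v i| ≤ r) : ‖v‖ ≤ n * r := by
  have : v = ∑ i, v i • EuclideanSpace.single i (1 : ℝ) := by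
    ext j
    simp [Finset.sum_apply, Pi.single_apply]
  rw [this]
  refine (norm_sum_le _ _).trans ?_
  calc ∑ i, ‖v i • EuclideanSpace.single i (1 : ℝ)‖ ≤ ∑ _i : Fin n, r := by
        refine Finset.sum_le_sum fun i _ => ?_
        simpa [norm_smul] using h i
    _ = n * r := by simp

variable {n : ℕ} {G : Type*} [TopologicalSpace G] [ChartedSpace (EuclideanSpace ℝ (Fin n)) G]
  {X : Type*} [TopologicalSpace X] [ChartedSpace (EuclideanSpace ℝ (Fin n)) X] [CompactSpace X]
  {F : Type*} [NormedAddCommGroup F] [NormedSpace ℝ F]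

/-- A `C¹` function is locally Lipschitz in a chart, uniformly with respect to a parameter in a
compact manifold. -/
theorem exists_lipschitz_extChartAt {Θ : G × X → F}
    (hΘ : ContMDiff ((𝓡 n).prod (𝓡 n)) 𝓘(ℝ, F) 1 Θ) (g₀ : G) :
    ∃ U ∈ 𝓝 g₀, ∃ C : ℝ, 0 ≤ C ∧ ∀ g ∈ U, ∀ g' ∈ U, ∀ h,
      ‖Θ (g, h) - Θ (g', h)‖ ≤ C * ‖extChartAt (𝓡 n) g₀ g - extChartAt (𝓡 n) g₀ g'‖ := by
  have hloc (h₀ : X) : ∃ U ∈ 𝓝 g₀, ∃ W ∈ 𝓝 h₀, ∃ C : ℝ, 0 ≤ C ∧ ∀ g ∈ U, ∀ g' ∈ U, ∀ h ∈ W,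
      ‖Θ (g, h) - Θ (g', h)‖ ≤ C * ‖extChartAt (𝓡 n) g₀ g - extChartAt (𝓡 n) g₀ g'‖ := by
    have h1 := (contMDiffAt_iff.1 (hΘ (g₀, h₀))).2
    rw [ModelWithCorners.Boundaryless.range_eq_univ, contDiffWithinAt_univ] at h1
    obtain ⟨K, t, ht, hK⟩ := h1.exists_lipschitzOnWith
    have h2 : extChartAt ((𝓡 n).prod (𝓡 n)) (g₀, h₀) ⁻¹' t ∩
        (extChartAt ((𝓡 n).prod (𝓡 n)) (g₀, h₀)).source ∈ 𝓝 (g₀, h₀) :=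
      inter_mem ((continuousAt_extChartAt _).preimage_mem_nhds ht) (extChartAt_source_mem_nhds _)
    obtain ⟨U, hU, W, hW, hUW⟩ := mem_nhds_prod_iff.1 h2
    refine ⟨U, hU, W, hW, K, K.2, fun g hg g' hg' h hh => ?_⟩
    have hp := hUW (Set.mk_mem_prod hg hh)
    have hp' := hUW (Set.mk_mem_prod hg' hh)
    have := hK.dist_le_mul _ hp.1 _ hp'.1
    simp only [Function.comp_apply, PartialEquiv.left_inv _ hp.2, PartialEquiv.left_inv _ hp'.2,
      extChartAt_model_space_eq_id, PartialEquiv.refl_coe, id] at this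
    rw [dist_eq_norm] at this
    refine this.trans_eq ?_
    rw [extChartAt_prod]
    simp [dist_eq_norm, Prod.norm_def]
  -- Compactness of the parameter space makes the neighbourhood and the constant uniform in `h`.
  choose U hU W hW C hC H using hloc
  obtain ⟨T, hT⟩ := isCompact_univ.elim_nhds_subcover W fun x _ => hW x
  refine ⟨⋂ x ∈ T, U x, (Filter.biInter_finset_mem T).2 fun x _ => hU x, ∑ x ∈ T, C x,
    Finset.sum_nonneg fun x _ => hC x, fun g hg g' hg' h => ?_⟩
  obtain ⟨x, hx, hxW⟩ := Set.mem_iUnion₂.1 (hT.2 (Set.mem_univ h))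
  simp only [Set.mem_iInter] at hg hg'
  refine (H x g (hg x hx) g' (hg' x hx) h hxW).trans ?_
  gcongr
  exact Finset.single_le_sum (f := C) (fun x _ => hC x) hx

end Volume

/-! ### The trace inequality for elements of class `C¹` -/

section Trace

variable {n : ℕ} {G : Type*} [TopologicalSpace G] [ChartedSpace (EuclideanSpace ℝ (Fin n)) G]
  [Group G] [LieGroup (𝓡 n) ∞ G] [CompactSpace G] [MeasurableSpace G] [BorelSpace G]
  {A : Type*} [CStarAlgebra A] {μ : Measure G} [IsProbabilityMeasure μ] [μ.IsHaarMeasure]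
  {α : G →* (A ≃⋆ₐ[ℂ] A)}

/-- The elements that move a `C¹` orbit by at most `δ / K` have measure at least `c K⁻ⁿ`. -/
theorem exists_le_pow_mul_measureReal (x : C1 n α) {δ : ℝ} (hδ : 0 < δ) :
    ∃ c > 0, ∀ K : ℕ, 0 < K →
      c ≤ (K : ℝ) ^ n * μ.real {g : G | ∀ h, ‖α g (α h (x : A)) - α h (x : A)‖ ≤ δ / K} := by
  have : IsTopologicalGroup G := topologicalGroup_of_lieGroup (𝓡 n) ∞
  have hmul : ContMDiff ((𝓡 n).prod (𝓡 n)) (𝓡 n) 1 fun p : G × G => p.1 * p.2 :=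
    (contMDiff_mul (𝓡 n) ∞).of_le (by simp)
  have hΘ : ContMDiff ((𝓡 n).prod (𝓡 n)) 𝓘(ℝ, A) 1 fun p : G × G => α (p.1 * p.2) (x : A) :=
    ContMDiff.comp (g := fun g : G => α g (x : A)) x.2 hmul
  obtain ⟨U₀, hU₀, C, hC, hL⟩ := exists_lipschitz_extChartAt hΘ 1
  set χ := extChartAt (𝓡 n) (1 : G) with hχ
  obtain ⟨R, hR⟩ : ∃ R : ℕ, ‖χ 1‖ < R := exists_nat_gt _
  let U : Set G := U₀ ∩ χ ⁻¹' {v | ‖v‖ < R}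
  have hU : U ∈ 𝓝 (1 : G) := inter_mem hU₀ ((continuousAt_extChartAt (1 : G)).preimage_mem_nhds
    ((isOpen_lt continuous_norm continuous_const).mem_nhds hR))
  have hμU : 0 < μ.real U := by
    rw [measureReal_def, ENNReal.toReal_pos_iff]
    exact ⟨Measure.measure_pos_of_mem_nhds μ hU, measure_lt_top μ U⟩
  -- Cubes of side `1/(mK)` have diameter at most `n/(mK)`, so two elements of one cube move the
  -- orbit apart by at most `Cn/(mK) ≤ δ/K`.
  obtain ⟨m, hm⟩ : ∃ m : ℕ, C * n / δ < m := exists_nat_gt _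
  have hm0 : 0 < m := by
    have : 0 ≤ C * n / δ := by positivity
    exact_mod_cast this.trans_lt hm
  refine ⟨μ.real U / (2 * R * m + 1) ^ n, by positivity, fun K hK => ?_⟩
  set B : Set G := {g : G | ∀ h, ‖α g (α h (x : A)) - α h (x : A)‖ ≤ δ / K} with hB
  have hK1 : (1 : ℝ) ≤ K := by exact_mod_cast hK
  let N : ℕ := m * K
  have hN : (0 : ℝ) < N := by positivity
  -- Cells are cubes of side `1/N` in the chart at `1`. Coordinates on `U` lie in `(-R, R)`, so at
  -- most `(2RN)^n` cells occur, a number proportional to `K^n`.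
  have hcard := measureReal_le_card_mul (μ := μ) (U := U) (B := B)
    (Fintype.piFinset fun _ : Fin n => Finset.Ico (-(R * N : ℤ)) (R * N))
    (fun g i => ⌊N * χ g i⌋) ?_ ?_
  · rw [div_le_iff₀ (by positivity)]
    refine hcard.trans ?_
    have h1 : ((R * N : ℤ) - -(R * N : ℤ)).toNat = 2 * R * m * K := by
      have : ((R * N : ℤ) - -(R * N : ℤ)) = ((2 * R * m * K : ℕ) : ℤ) := by
        simp only [N]; push_cast; ring
      rw [this]; exact Int.toNat_natCast _
    have h2 : (((Fintype.piFinset fun _ : Fin n =>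
        Finset.Ico (-(R * N : ℤ)) (R * N)).card : ℕ) : ℝ) = (2 * R * m * K) ^ n := by
      rw [Fintype.card_piFinset]
      simp only [Int.card_Ico, h1]
      simp
    rw [h2, mul_right_comm (_ ^ n), ← mul_pow]
    have h3 : (2 * R * m * K : ℝ) ≤ K * (2 * R * m + 1) := by nlinarith
    gcongr
  · intro g hg
    rw [Fintype.mem_piFinset]
    intro i
    have h1 : |χ g i| < R := (PiLp.norm_apply_le (χ g) i).trans_lt hg.2
    rw [abs_lt] at h1
    rw [Finset.mem_Ico, Int.le_floor, Int.floor_lt]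
    push_cast
    constructor <;> nlinarith
  · intro g hg g' hg' hc h
    have h1 : ‖χ g - χ g'‖ ≤ n * (1 / N) := by
      refine EuclideanSpace.norm_le_card_mul fun i => ?_
      have := Int.abs_sub_lt_one_of_floor_eq_floor (congrFun hc i)
      rw [← mul_sub, abs_mul, abs_of_pos hN] at this
      rw [le_div_iff₀ hN, PiLp.sub_apply]
      linarith
    have h2 := hL g hg.1 g' hg'.1 h
    -- `α_{g'}` is isometric, so the displacement by `g'⁻¹ g` is the distance between two values of
    -- the `C¹` map.
    have e : ‖α (g'⁻¹ * g) (α h (x : A)) - α h (x : A)‖ =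
        ‖α (g * h) (x : A) - α (g' * h) (x : A)‖ := by
      rw [← (AddMonoidHomClass.isometry_iff_norm (α g')).1 (StarAlgEquiv.isometry (α g'))
        (α (g'⁻¹ * g) (α h (x : A)) - α h (x : A))]
      rw [map_sub, ← StarAlgEquiv.mul_apply, ← StarAlgEquiv.mul_apply, ← StarAlgEquiv.mul_apply,
        ← map_mul, ← map_mul, ← map_mul]
      congr 4
      group
    rw [e]
    refine (h2.trans (mul_le_mul_of_nonneg_left h1 hC)).trans ?_
    rw [div_lt_iff₀ hδ] at hm
    simp only [N, Nat.cast_mul]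
    rw [mul_one_div, mul_div_assoc', div_le_div_iff₀ (by positivity) (by positivity)]
    nlinarith

variable [PartialOrder A] [StarOrderedRing A] {φ : A →ₚ[ℂ] ℂ}

/-- If `σ < ρ`, the power inequality and the volume bound would give `c/4 ≤ K^n (σ/ρ)^K` for every
`K ≥ 1`, and the right side tends to `0`. -/
theorem rsq_le_lsq_of_mem_C1 [SecondCountableTopology G] [μ.IsInvInvariant]
    (hα : ∀ a : A, Continuous fun g : G => α g a) (hφ : φ 1 = 1)
    (hinv : ∀ (g : G) (a : A), φ (α g a) = φ a)
    (havg : ∀ a, ∫ g, α g a ∂μ = φ a • (1 : A)) (x : C1 n α) :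
    rsq φ (x : A) ≤ lsq φ (x : A) := by
  have : IsTopologicalGroup G := topologicalGroup_of_lieGroup (𝓡 n) ∞
  by_contra! hlt
  set ρ := rsq φ (x : A) with hρ
  set σ := lsq φ (x : A) with hσ
  have hσ0 : 0 ≤ σ := lsq_nonneg φ _
  have hρ0 : 0 < ρ := hσ0.trans_lt hlt
  -- For `ε = √ρ / (5K)` one has `25 K² ε² = ρ`, the limiting case of the smallness condition.
  obtain ⟨c, hc, hvol⟩ := exists_le_pow_mul_measureReal (μ := μ) x
    (δ := Real.sqrt ρ / 5) (by positivity)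
  have key (K : ℕ) (hK : 0 < K) : c / 4 ≤ (K : ℝ) ^ n * (σ / ρ) ^ K := by
    have hK1 : (0 : ℝ) < K := by exact_mod_cast hK
    have hBc : IsClosed {g : G | ∀ h, ‖α g (α h (x : A)) - α h (x : A)‖ ≤ Real.sqrt ρ / 5 / K} := by
      rw [Set.ofPred_forall]
      exact isClosed_iInter fun h => isClosed_le ((hα _).sub continuous_const).norm continuous_const
    have h1 := measure_mul_rsq_pow_le hα hφ hinv havg (x := (x : A)) hBc.measurableSet
      (fun g hg => hg) hK (by
        rw [div_pow, div_pow, Real.sq_sqrt hρ0.le]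
        rw [← hρ]
        field_simp
        norm_num)
    have h2 := hvol K hK
    rw [← hρ, ← hσ] at h1
    rw [div_pow, mul_div_assoc', le_div_iff₀ (by positivity)]
    have h3 := mul_le_mul_of_nonneg_left h1 (pow_nonneg hK1.le n)
    have h4 := mul_le_mul_of_nonneg_right h2 (pow_nonneg hρ0.le K)
    nlinarith
  have hlim := tendsto_pow_const_mul_const_pow_of_abs_lt_one n (r := σ / ρ)
    (by rw [abs_of_nonneg (by positivity), div_lt_one hρ0]; exact hlt)
  have := ge_of_tendsto hlim (eventually_atTop.2 ⟨1, fun K hK => key K hK⟩)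
  linarith

end Trace

/-! ### Differentiation under the integral sign over a compact space -/

section ParametricEuclidean

theorem exists_ball_bound {E X F : Type*} [SeminormedAddCommGroup E] [ProperSpace E]
    [TopologicalSpace X] [CompactSpace X] [SeminormedAddCommGroup F] {U : Set E}
    (hU : IsOpen U) {f : E × X → F} (hf : ContinuousOn f (U ×ˢ Set.univ))
    {v : E} (hv : v ∈ U) : ∃ s ∈ 𝓝 v, s ⊆ U ∧ ∃ C, ∀ w ∈ s, ∀ x, ‖f (w, x)‖ ≤ C := by
  obtain ⟨r, hr, hrU⟩ := Metric.nhds_basis_closedBall.mem_iff.1 (hU.mem_nhds hv)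
  obtain ⟨C, hC⟩ := ((isCompact_closedBall v r).prod isCompact_univ).exists_bound_of_continuousOn
    (hf.mono (Set.prod_mono hrU subset_rfl))
  exact ⟨_, Metric.closedBall_mem_nhds v hr, hrU, C, fun w hw x => hC _ ⟨hw, trivial⟩⟩

theorem continuous_slice {E X F : Type*} [TopologicalSpace E] [TopologicalSpace X]
    [TopologicalSpace F] {U : Set E} {f : E × X → F} (hf : ContinuousOn f (U ×ˢ Set.univ)) {v : E}
    (hv : v ∈ U) : Continuous fun x => f (v, x) := by
  rw [← continuousOn_univ]
  exact hf.comp (by fun_prop) fun x _ => ⟨hv, trivial⟩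

variable {E X F : Type*} [NormedAddCommGroup E] [ProperSpace E]
  [TopologicalSpace X] [CompactSpace X] [MeasurableSpace X] [BorelSpace X]
  [NormedAddCommGroup F] [NormedSpace ℝ F] {μ : Measure X} [IsFiniteMeasure μ] {U : Set E}

theorem continuousOn_integral_of_continuousOn (hU : IsOpen U) {f : E × X → F}
    (hf : ContinuousOn f (U ×ˢ Set.univ)) : ContinuousOn (fun v => ∫ x, f (v, x) ∂μ) U := by
  intro v hv
  obtain ⟨s, hs, hsU, C, hC⟩ := exists_ball_bound hU hf hv
  refine (continuousAt_of_dominated (bound := fun _ => C) ?_ ?_ (integrable_const C)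
    (ae_of_all _ fun x => ?_)).continuousWithinAt
  · filter_upwards [hU.mem_nhds hv] with w hw
    exact (integrable_of_continuous_compact (continuous_slice hf hw)).aestronglyMeasurable
  · filter_upwards [hs] with w hw
    exact ae_of_all _ (hC w hw)
  · exact ((hf (v, x) ⟨hv, trivial⟩).continuousAt ((hU.prod isOpen_univ).mem_nhds
      ⟨hv, trivial⟩)).comp (f := fun w => (w, x)) (by fun_prop)

variable [NormedSpace ℝ E]

/-- Differentiation under the integral sign over a compact space. -/
theorem hasFDerivAt_integral_of_continuousOn (hU : IsOpen U) {f : E × X → F}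
    {f' : E × X → E →L[ℝ] F} (hf : ContinuousOn f (U ×ˢ Set.univ))
    (hf' : ContinuousOn f' (U ×ˢ Set.univ))
    (hd : ∀ v ∈ U, ∀ x, HasFDerivAt (fun w => f (w, x)) (f' (v, x)) v) {v : E} (hv : v ∈ U) :
    HasFDerivAt (fun v => ∫ x, f (v, x) ∂μ) (∫ x, f' (v, x) ∂μ) v := by
  obtain ⟨s, hs, hsU, C, hC⟩ := exists_ball_bound hU hf' hv
  refine hasFDerivAt_integral_of_dominated_of_fderiv_le (s := s) (bound := fun _ => C) hs ?_ ?_ ?_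
    (ae_of_all _ fun x w hw => hC w hw x) (integrable_const C)
    (ae_of_all _ fun x w hw => hd w (hsU hw) x)
  · filter_upwards [hU.mem_nhds hv] with w hw
    exact (integrable_of_continuous_compact (continuous_slice hf hw)).aestronglyMeasurable
  · exact integrable_of_continuous_compact (continuous_slice hf hv)
  · exact (integrable_of_continuous_compact (continuous_slice hf' hv)).aestronglyMeasurable

end ParametricEuclidean

/-! ### Differentiation under the integral sign on manifolds -/

section ParametricManifold

variable {n : ℕ} {G : Type*} [TopologicalSpace G] [ChartedSpace (EuclideanSpace ℝ (Fin n)) G]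
  {F : Type*} [NormedAddCommGroup F] [NormedSpace ℝ F]

/-- The derivative of a vector-valued function in the direction of a tangent vector. -/
def dirDeriv (f : G → F) (g : G) (Y : EuclideanSpace ℝ (Fin n)) : F :=
  mfderiv (𝓡 n) 𝓘(ℝ, F) f g Y

theorem mfderiv_eq_fderiv_extChartAt {f : G → F} {g : G} (hf : MDifferentiableAt (𝓡 n) 𝓘(ℝ, F) f g) :
    mfderiv (𝓡 n) 𝓘(ℝ, F) f g =
      fderiv ℝ (f ∘ (extChartAt (𝓡 n) g).symm) (extChartAt (𝓡 n) g g) := by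
  rw [hf.mfderiv, ModelWithCorners.Boundaryless.range_eq_univ, fderivWithin_univ]
  rfl

theorem dirDeriv_eq_fderiv {f : G → F} {g : G} (hf : MDifferentiableAt (𝓡 n) 𝓘(ℝ, F) f g)
    (Y : EuclideanSpace ℝ (Fin n)) :
    dirDeriv f g Y = fderiv ℝ (f ∘ (extChartAt (𝓡 n) g).symm) (extChartAt (𝓡 n) g g) Y := by
  rw [dirDeriv, mfderiv_eq_fderiv_extChartAt hf]
  rfl

variable [IsManifold (𝓡 n) 1 G]
  {X : Type*} [TopologicalSpace X] [ChartedSpace (EuclideanSpace ℝ (Fin n)) X] 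
  {V : Type*} [NormedAddCommGroup V] [NormedSpace ℝ V]

theorem differentiableAt_extChartAt_symm {Θ : G × X → V}
    (hΘ : ContMDiff ((𝓡 n).prod (𝓡 n)) 𝓘(ℝ, V) 1 Θ) (g₀ : G)
    {v : EuclideanSpace ℝ (Fin n)} (hv : v ∈ (extChartAt (𝓡 n) g₀).target) (x : X) :
    DifferentiableAt ℝ (fun v => Θ ((extChartAt (𝓡 n) g₀).symm v, x)) v := by
  have hT := isOpen_extChartAt_target (I := 𝓡 n) g₀
  refine ((contMDiffAt_iff_contDiffAt (n := 1)).1 ?_).differentiableAt one_ne_zero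
  refine (hΘ _).comp v (ContMDiffAt.prodMk ?_ contMDiffAt_const)
  exact (contMDiffOn_extChartAt_symm g₀).contMDiffAt (hT.mem_nhds hv)

variable [IsManifold (𝓡 n) 1 X]

/-- The first derivative of a `C¹` function, taken in a chart of the first factor of a product,
is continuous. -/
theorem continuousOn_fderiv_extChartAt {Θ : G × X → V}
    (hΘ : ContMDiff ((𝓡 n).prod (𝓡 n)) 𝓘(ℝ, V) 1 Θ) (g₀ : G) :
    ContinuousOn (fun p : EuclideanSpace ℝ (Fin n) × X =>
      fderiv ℝ (fun v => Θ ((extChartAt (𝓡 n) g₀).symm v, p.2)) p.1)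
      ((extChartAt (𝓡 n) g₀).target ×ˢ Set.univ) := by
  rintro ⟨v₀, x₀⟩ ⟨hv, -⟩
  have hT := isOpen_extChartAt_target (I := 𝓡 n) g₀
  have h1 : ContMDiffAt ((𝓘(ℝ, EuclideanSpace ℝ (Fin n)).prod (𝓡 n)).prod
      𝓘(ℝ, EuclideanSpace ℝ (Fin n))) 𝓘(ℝ, V) 1
      (Function.uncurry fun (p : EuclideanSpace ℝ (Fin n) × X) v =>
        Θ ((extChartAt (𝓡 n) g₀).symm v, p.2)) ((v₀, x₀), v₀) := by
    refine (hΘ _).comp ((v₀, x₀), v₀) (ContMDiffAt.prodMk ?_ ?_)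
    · refine ContMDiffAt.comp (I' := 𝓘(ℝ, EuclideanSpace ℝ (Fin n)))
        (g := (extChartAt (𝓡 n) g₀).symm) (f := Prod.snd) _ ?_ contMDiffAt_snd
      exact (contMDiffOn_extChartAt_symm g₀).contMDiffAt (hT.mem_nhds hv)
    · exact contMDiffAt_snd.comp _ contMDiffAt_fst
  have h2 := ContMDiffAt.mfderiv (m := 0) (x₀ := (v₀, x₀)) _ Prod.fst h1 contMDiffAt_fst (by simp)
  simp only [inTangentCoordinates_model_space, mfderiv_eq_fderiv] at h2
  exact h2.continuousAt.continuousWithinAt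

variable [CompactSpace X] [MeasurableSpace X] [BorelSpace X] {μ : Measure X} [IsFiniteMeasure μ]

/-- Differentiation under the integral sign on a compact manifold of parameters. -/
theorem contMDiff_integral_and_mfderiv [CompleteSpace F] {Θ : G × X → V}
    (hΘ : ContMDiff ((𝓡 n).prod (𝓡 n)) 𝓘(ℝ, V) 1 Θ) {b : X → V →L[ℝ] F} (hb : Continuous b) :
    ContMDiff (𝓡 n) 𝓘(ℝ, F) 1 (fun g => ∫ x, b x (Θ (g, x)) ∂μ) ∧
    ∀ (g : G) (Y : EuclideanSpace ℝ (Fin n)), dirDeriv (fun g => ∫ x, b x (Θ (g, x)) ∂μ) g Y =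
      ∫ x, b x (dirDeriv (fun g => Θ (g, x)) g Y) ∂μ := by
  set J : G → F := fun g => ∫ x, b x (Θ (g, x)) ∂μ with hJ
  have main (g₀ : G) : ContMDiffAt (𝓡 n) 𝓘(ℝ, F) 1 J g₀ ∧
      fderiv ℝ (J ∘ (extChartAt (𝓡 n) g₀).symm) (extChartAt (𝓡 n) g₀ g₀) =
        ∫ x, (b x).comp (fderiv ℝ (fun v => Θ ((extChartAt (𝓡 n) g₀).symm v, x))
          (extChartAt (𝓡 n) g₀ g₀)) ∂μ := by
    set χ := extChartAt (𝓡 n) g₀ with hχ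
    have hT : IsOpen χ.target := isOpen_extChartAt_target g₀
    have hD := continuousOn_fderiv_extChartAt hΘ g₀
    have hf : ContinuousOn (fun p : EuclideanSpace ℝ (Fin n) × X => b p.2 (Θ (χ.symm p.1, p.2)))
        (χ.target ×ˢ Set.univ) := by
      refine ContinuousOn.clm_apply (by fun_prop) (hΘ.continuous.comp_continuousOn ?_)
      exact ((continuousOn_extChartAt_symm g₀).comp continuousOn_fst fun p hp => hp.1).prodMk
        continuousOn_snd
    have hf' := ContinuousOn.clm_comp (hb.comp_continuousOn (continuousOn_snd)) hD
    have hd (v) (hv : v ∈ χ.target) (x : X) := (b x).hasFDerivAt.comp v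
      (differentiableAt_extChartAt_symm hΘ g₀ hv x).hasFDerivAt
    have hJd (v) (hv : v ∈ χ.target) := hasFDerivAt_integral_of_continuousOn (μ := μ) hT hf hf' hd hv
    have hJc := continuousOn_integral_of_continuousOn (μ := μ) hT hf'
    have hg₀ : χ g₀ ∈ χ.target := mem_extChartAt_target g₀
    refine ⟨?_, (hJd _ hg₀).fderiv⟩
    have h1 : ContDiffAt ℝ 1 (J ∘ χ.symm) (χ g₀) :=
      contDiffAt_one_iff.2 ⟨_, χ.target, hT.mem_nhds hg₀, hJc, hJd⟩
    refine (h1.contMDiffAt.comp g₀ (contMDiffAt_extChartAt (n := 1))).congr_of_eventuallyEq ?_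
    filter_upwards [extChartAt_source_mem_nhds (I := 𝓡 n) g₀] with g hg
    simp [χ.left_inv hg]
  refine ⟨fun g => (main g).1, fun g Y => ?_⟩
  have hg : extChartAt (𝓡 n) g g ∈ (extChartAt (𝓡 n) g).target := mem_extChartAt_target g
  rw [dirDeriv_eq_fderiv ((main g).1.mdifferentiableAt one_ne_zero), (main g).2,
    ContinuousLinearMap.integral_apply]
  · congr 1
    ext x
    rw [dirDeriv_eq_fderiv]
    · rfl
    · exact ((hΘ.comp (contMDiff_id.prodMk contMDiff_const)) g).mdifferentiableAt one_ne_zero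
  · refine integrable_of_continuous_compact (hb.clm_comp ?_)
    exact continuous_slice (continuousOn_fderiv_extChartAt hΘ g) hg

end ParametricManifold

/-! ### The Lie bracket as a commutator of derivations -/

section Bracket

open VectorField

variable {n : ℕ} {M : Type*} [TopologicalSpace M] [ChartedSpace (EuclideanSpace ℝ (Fin n)) M]
  {F : Type*} [NormedAddCommGroup F] [NormedSpace ℝ F]

/-- A vector field in the chart at `x₀`. -/
def chartField (V : ∀ x : M, TangentSpace (𝓡 n) x) (x₀ : M) :
    EuclideanSpace ℝ (Fin n) → EuclideanSpace ℝ (Fin n) :=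
  mpullbackWithin 𝓘(ℝ, EuclideanSpace ℝ (Fin n)) (𝓡 n) (extChartAt (𝓡 n) x₀).symm V
    (Set.range (𝓡 n))

variable [IsManifold (𝓡 n) 1 M]

theorem dirDeriv_extChartAt_symm {f : M → F} {x₀ : M} {v : EuclideanSpace ℝ (Fin n)}
    (hv : v ∈ (extChartAt (𝓡 n) x₀).target)
    (hf : MDifferentiableAt (𝓡 n) 𝓘(ℝ, F) f ((extChartAt (𝓡 n) x₀).symm v))
    (V : ∀ x : M, TangentSpace (𝓡 n) x) :
    dirDeriv f ((extChartAt (𝓡 n) x₀).symm v) (V ((extChartAt (𝓡 n) x₀).symm v)) =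
      fderiv ℝ (f ∘ (extChartAt (𝓡 n) x₀).symm) v (chartField V x₀ v) := by
  have hs : MDifferentiableWithinAt 𝓘(ℝ, EuclideanSpace ℝ (Fin n)) (𝓡 n)
      (extChartAt (𝓡 n) x₀).symm (Set.range (𝓡 n)) v := mdifferentiableWithinAt_extChartAt_symm hv
  have h1 := mfderiv_comp_mfderivWithin v hf hs (by
    rw [ModelWithCorners.Boundaryless.range_eq_univ]; exact uniqueMDiffWithinAt_univ _)
  have h2 : (mfderivWithin 𝓘(ℝ, EuclideanSpace ℝ (Fin n)) (𝓡 n)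
      (extChartAt (𝓡 n) x₀).symm (Set.range (𝓡 n)) v) (chartField V x₀ v) =
      V ((extChartAt (𝓡 n) x₀).symm v) :=
    (isInvertible_mfderivWithin_extChartAt_symm hv).self_apply_inverse _
  have h3 := congrArg (fun L => L (chartField V x₀ v)) h1
  have h4 : fderiv ℝ (f ∘ (extChartAt (𝓡 n) x₀).symm) v =
      mfderivWithin 𝓘(ℝ, EuclideanSpace ℝ (Fin n)) 𝓘(ℝ, F) (f ∘ (extChartAt (𝓡 n) x₀).symm)
        (Set.range (𝓡 n)) v := by
    rw [ModelWithCorners.Boundaryless.range_eq_univ, mfderivWithin_univ, mfderiv_eq_fderiv]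
  rw [h4]
  refine Eq.trans ?_ h3.symm
  exact congrArg (mfderiv (𝓡 n) 𝓘(ℝ, F) f ((extChartAt (𝓡 n) x₀).symm v)) h2.symm

/-- The bracket of vector fields is the commutator of the associated derivations. -/
theorem dirDeriv_mlieBracket [IsManifold (𝓡 n) 2 M] {f : M → F} {V W : ∀ x : M, TangentSpace (𝓡 n) x} {x₀ : M}
    (hf : ContMDiff (𝓡 n) 𝓘(ℝ, F) 2 f)
    (hV : MDifferentiableAt (𝓡 n) ((𝓡 n).tangent) (fun x => (V x : TangentBundle (𝓡 n) M)) x₀)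
    (hW : MDifferentiableAt (𝓡 n) ((𝓡 n).tangent) (fun x => (W x : TangentBundle (𝓡 n) M)) x₀)
    (hfV : MDifferentiableAt (𝓡 n) 𝓘(ℝ, F) (fun x => dirDeriv f x (V x)) x₀)
    (hfW : MDifferentiableAt (𝓡 n) 𝓘(ℝ, F) (fun x => dirDeriv f x (W x)) x₀) :
    dirDeriv f x₀ (mlieBracket (𝓡 n) V W x₀) =
      dirDeriv (fun x => dirDeriv f x (W x)) x₀ (V x₀) -
        dirDeriv (fun x => dirDeriv f x (V x)) x₀ (W x₀) := by
  set χ := extChartAt (𝓡 n) x₀ with hχ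
  have hT : χ.target ∈ 𝓝 (χ x₀) := extChartAt_target_mem_nhds x₀
  have hx : χ x₀ ∈ χ.target := mem_extChartAt_target x₀
  have hinv : χ.symm (χ x₀) = x₀ := extChartAt_to_inv x₀
  have hfd (x : M) : MDifferentiableAt (𝓡 n) 𝓘(ℝ, F) f x := (hf x).mdifferentiableAt two_ne_zero
  have hfχ : ContDiffAt ℝ 2 (f ∘ χ.symm) (χ x₀) := by
    refine contMDiffAt_iff_contDiffAt.1 ((hf _).comp _ ?_)
    exact (contMDiffOn_extChartAt_symm x₀).contMDiffAt hT
  have hf2 : DifferentiableAt ℝ (fderiv ℝ (f ∘ χ.symm)) (χ x₀) :=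
    (hfχ.fderiv_right (m := 1) (by norm_num)).differentiableAt one_ne_zero
  have hsymm : IsSymmSndFDerivAt ℝ (f ∘ χ.symm) (χ x₀) :=
    hfχ.isSymmSndFDerivAt (by simp)
  have hVd (V : ∀ x : M, TangentSpace (𝓡 n) x)
      (hV : MDifferentiableAt (𝓡 n) ((𝓡 n).tangent) (fun x => (V x : TangentBundle (𝓡 n) M)) x₀) :
      DifferentiableAt ℝ (chartField V x₀) (χ x₀) := by
    have : DifferentiableWithinAt ℝ (chartField V x₀)
        (χ.symm ⁻¹' Set.univ ∩ Set.range (𝓡 n)) (χ x₀) :=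
      MDifferentiableWithinAt.differentiableWithinAt_mpullbackWithin_vectorField
        (mdifferentiableWithinAt_univ.2 hV)
    rwa [Set.preimage_univ, ModelWithCorners.Boundaryless.range_eq_univ, Set.univ_inter,
      differentiableWithinAt_univ] at this
  -- In the chart an iterated derivative is a second derivative of `f` plus a first derivative of
  -- `f` along the derivative of the inner field. By symmetry the second derivatives cancel in the
  -- commutator, and what remains is the bracket of the chart fields.
  have key (V W : ∀ x : M, TangentSpace (𝓡 n) x)
      (hW : MDifferentiableAt (𝓡 n) ((𝓡 n).tangent) (fun x => (W x : TangentBundle (𝓡 n) M)) x₀)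
      (hfW : MDifferentiableAt (𝓡 n) 𝓘(ℝ, F) (fun x => dirDeriv f x (W x)) x₀) :
      dirDeriv (fun x => dirDeriv f x (W x)) x₀ (V x₀) =
        fderiv ℝ (fderiv ℝ (f ∘ χ.symm)) (χ x₀) (chartField V x₀ (χ x₀)) (chartField W x₀ (χ x₀)) +
        fderiv ℝ (f ∘ χ.symm) (χ x₀) (fderiv ℝ (chartField W x₀) (χ x₀) (chartField V x₀ (χ x₀))) := by
    have h1 := dirDeriv_extChartAt_symm hx (f := fun x => dirDeriv f x (W x))
      (by rw [hinv]; exact hfW) V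
    rw [hinv] at h1
    rw [h1]
    have h2 : (fun x => dirDeriv f x (W x)) ∘ χ.symm =ᶠ[𝓝 (χ x₀)]
        fun v => fderiv ℝ (f ∘ χ.symm) v (chartField W x₀ v) := by
      filter_upwards [hT] with v hv
      exact dirDeriv_extChartAt_symm hv (hfd _) W
    rw [h2.fderiv_eq, fderiv_clm_apply hf2 (hVd W hW)]
    simp [add_comm]
  rw [key V W hW hfW, key W V hV hfV, hsymm]
  have h3 : mfderiv (𝓡 n) 𝓘(ℝ, F) f x₀ =
      (fderiv ℝ (f ∘ χ.symm) (χ x₀)).comp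
        (mfderiv (𝓡 n) 𝓘(ℝ, EuclideanSpace ℝ (Fin n)) χ x₀) := by
    have h4 : f =ᶠ[𝓝 x₀] (f ∘ χ.symm) ∘ χ := by
      filter_upwards [extChartAt_source_mem_nhds (I := 𝓡 n) x₀] with x hx
      simp [χ.left_inv hx]
    rw [h4.mfderiv_eq, mfderiv_comp x₀
      (hfχ.differentiableAt two_ne_zero).mdifferentiableAt
      (mdifferentiableAt_extChartAt (mem_chart_source _ x₀)), mfderiv_eq_fderiv]
    rfl
  -- The manifold bracket is by definition the pullback of the bracket in the chart; applying
  -- `mfderiv f` through the chart undoes the pullback.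
  have h5 : mlieBracket (𝓡 n) V W x₀ = (mfderiv (𝓡 n) 𝓘(ℝ, EuclideanSpace ℝ (Fin n)) χ x₀).inverse
      (lieBracket ℝ (E := EuclideanSpace ℝ (Fin n)) (chartField V x₀) (chartField W x₀) (χ x₀)) := by
    have h6 : χ.symm ⁻¹' Set.univ ∩ Set.range (𝓡 n) = Set.univ := by
      rw [Set.preimage_univ, ModelWithCorners.Boundaryless.range_eq_univ, Set.univ_inter]
    rw [← lieBracketWithin_univ, ← h6]
    rfl
  have h6 : dirDeriv f x₀ (mlieBracket (𝓡 n) V W x₀) = fderiv ℝ (f ∘ χ.symm) (χ x₀)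
      (lieBracket ℝ (E := EuclideanSpace ℝ (Fin n)) (chartField V x₀) (chartField W x₀) (χ x₀)) := by
    rw [h5]
    have := congrArg (fun L => L ((mfderiv (𝓡 n) 𝓘(ℝ, EuclideanSpace ℝ (Fin n)) χ x₀).inverse
      (lieBracket ℝ (E := EuclideanSpace ℝ (Fin n)) (chartField V x₀) (chartField W x₀) (χ x₀)))) h3
    refine this.trans ?_
    exact congrArg (fderiv ℝ (f ∘ χ.symm) (χ x₀))
      ((isInvertible_mfderiv_extChartAt (mem_extChartAt_source x₀)).self_apply_inverse _)
  rw [h6, lieBracket, map_sub]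
  abel

end Bracket

/-! ### Left-invariant derivations of smooth functions -/

section InvDeriv

open VectorField

variable {n : ℕ} {G : Type*} [TopologicalSpace G] [ChartedSpace (EuclideanSpace ℝ (Fin n)) G]
  [Group G] {F : Type*} [NormedAddCommGroup F] [NormedSpace ℝ F]

/-- The derivative of `f` along the left-invariant vector field with value `Y` at the identity. -/
def invDeriv (Y : EuclideanSpace ℝ (Fin n)) (f : G → F) (g : G) : F :=
  dirDeriv (fun h => f (g * h)) 1 Y

variable [LieGroup (𝓡 n) ∞ G]

theorem contMDiff_mul_left_infty (g : G) : ContMDiff (𝓡 n) (𝓡 n) ∞ fun h : G => g * h :=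
  contMDiff_mul_left

theorem invDeriv_eq_fderiv {f : G → F} (hf : ContMDiff (𝓡 n) 𝓘(ℝ, F) 1 f)
    (Y : EuclideanSpace ℝ (Fin n)) (g : G) :
    invDeriv Y f g = fderiv ℝ (fun v => f (g * (extChartAt (𝓡 n) (1 : G)).symm v))
      (extChartAt (𝓡 n) (1 : G) 1) Y :=
  dirDeriv_eq_fderiv ((hf.comp ((contMDiff_mul_left_infty g).of_le (by simp))
    1).mdifferentiableAt one_ne_zero) Y

/-- The derivative is taken at the fixed point `1`, in the second variable of the smooth map `(g, h)
↦ f(gh)`; `g` is only a parameter. -/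
theorem contMDiff_invDeriv {f : G → F} (hf : ContMDiff (𝓡 n) 𝓘(ℝ, F) ∞ f)
    (Y : EuclideanSpace ℝ (Fin n)) : ContMDiff (𝓡 n) 𝓘(ℝ, F) ∞ (invDeriv Y f) := by
  have : IsManifold (𝓡 n) 1 G := IsManifold.of_le (n := ∞) (by simp)
  have h0 : invDeriv Y f = fun g => fderiv ℝ
      (fun v => f (g * (extChartAt (𝓡 n) (1 : G)).symm v)) (extChartAt (𝓡 n) (1 : G) 1) Y :=
    funext fun g => invDeriv_eq_fderiv (hf.of_le (by simp)) Y g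
  rw [h0]
  intro g₀
  set v₀ := extChartAt (𝓡 n) (1 : G) 1
  have h1 : ContMDiffAt ((𝓡 n).prod 𝓘(ℝ, EuclideanSpace ℝ (Fin n))) 𝓘(ℝ, F) ∞
      (Function.uncurry fun (g : G) v => f (g * (extChartAt (𝓡 n) (1 : G)).symm v)) (g₀, v₀) := by
    refine (hf _).comp (g₀, v₀) (ContMDiffAt.mul contMDiffAt_fst ?_)
    refine ContMDiffAt.comp (I' := 𝓘(ℝ, EuclideanSpace ℝ (Fin n)))
        (g := (extChartAt (𝓡 n) (1 : G)).symm) (f := Prod.snd) _ ?_ contMDiffAt_snd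
    exact (contMDiffOn_extChartAt_symm 1).contMDiffAt
      (show (extChartAt (𝓡 n) (1 : G)).target ∈ 𝓝 v₀ from extChartAt_target_mem_nhds 1)
  have h2 := ContMDiffAt.mfderiv (m := ∞) (x₀ := g₀) _ (fun _ => v₀) h1 contMDiffAt_const (by simp)
  simp only [inTangentCoordinates_model_space, mfderiv_eq_fderiv] at h2
  exact h2.clm_apply contMDiffAt_const

theorem invDeriv_eq_dirDeriv {f : G → F} (hf : ContMDiff (𝓡 n) 𝓘(ℝ, F) 1 f)
    (Y : EuclideanSpace ℝ (Fin n)) (g : G) :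
    invDeriv Y f g = dirDeriv f g (mulInvariantVectorField (I := 𝓡 n) (G := G) Y g) := by
  have h1 := mfderiv_comp_of_eq (I := 𝓡 n) (I' := 𝓡 n) (I'' := 𝓘(ℝ, F)) (x := (1 : G)) (y := g)
    (g := f) (f := fun h => g * h)
    ((hf g).mdifferentiableAt one_ne_zero)
    ((contMDiff_mul_left_infty g 1).mdifferentiableAt (by simp)) (mul_one g)
  refine (congrArg (fun L => L Y) h1).trans ?_
  change dirDeriv f (g * 1) (mulInvariantVectorField (I := 𝓡 n) (G := G) Y g) = _
  rw [mul_one]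

/-- Left-invariant derivations satisfy the commutation relations of the Lie algebra. -/
theorem invDeriv_bracket {f : G → F} (hf : ContMDiff (𝓡 n) 𝓘(ℝ, F) ∞ f)
    (Y Z : GroupLieAlgebra (𝓡 n) G) (g : G) :
    invDeriv Y (invDeriv Z f) g - invDeriv Z (invDeriv Y f) g =
      invDeriv (⁅Y, Z⁆ : GroupLieAlgebra (𝓡 n) G) f g := by
  have : LieGroup (𝓡 n) (minSmoothness ℝ 3) G := LieGroup.of_le (n := ∞) (by
    simpa using ENat.LEInfty.out)
  have : IsManifold (𝓡 n) 2 G := IsManifold.of_le (n := ∞) ENat.LEInfty.out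
  have : IsManifold (𝓡 n) 1 G := IsManifold.of_le (n := ∞) (by simp)
  have hd (W : GroupLieAlgebra (𝓡 n) G) : invDeriv W f =
      fun g => dirDeriv f g (mulInvariantVectorField W g) :=
    funext fun g => invDeriv_eq_dirDeriv (hf.of_le (by simp)) W g
  have hm (W : GroupLieAlgebra (𝓡 n) G) : MDifferentiableAt (𝓡 n) 𝓘(ℝ, F)
      (fun g => dirDeriv f g (mulInvariantVectorField W g)) g := by
    rw [← hd]
    exact (contMDiff_invDeriv hf W g).mdifferentiableAt (by simp)
  have h := dirDeriv_mlieBracket (hf.of_le ENat.LEInfty.out)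
    (mdifferentiableAt_mulInvariantVectorField Y) (mdifferentiableAt_mulInvariantVectorField Z)
    (hm Y) (hm Z)
  rw [← hd Z, ← hd Y] at h
  have h1 := invDeriv_eq_dirDeriv ((contMDiff_invDeriv hf Z).of_le (by simp)) Y g
  have h2 := invDeriv_eq_dirDeriv ((contMDiff_invDeriv hf Y).of_le (by simp)) Z g
  have h3 := invDeriv_eq_dirDeriv (hf.of_le (by simp)) (⁅Y, Z⁆ : GroupLieAlgebra (𝓡 n) G) g
  -- The bracket of left-invariant fields is the left-invariant field of the Lie algebra bracket.
  have h4 := congrArg (dirDeriv f g) (congrFun (mulInvariantVector_mlieBracket Y Z) g)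
  exact (congrArg₂ (· - ·) h1 h2).trans (h.symm.trans (h3.trans h4).symm)

variable (n G) in
/-- The space of smooth complex-valued functions. -/
def Smooth : Submodule ℂ (G → ℂ) where
  carrier := {f | ContMDiff (𝓡 n) 𝓘(ℝ, ℂ) ∞ f}
  add_mem' hf hg := ContMDiff.add hf hg
  zero_mem' := contMDiff_const
  smul_mem' c _ hf :=
    (c • ContinuousLinearMap.id ℝ ℂ : ℂ →L[ℝ] ℂ).contMDiff.comp hf

theorem invDeriv_clm_comp {E : Type*} [NormedAddCommGroup E] [NormedSpace ℝ E] (L : F →L[ℝ] E)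
    {f : G → F} (hf : ContMDiff (𝓡 n) 𝓘(ℝ, F) 1 f) (Y : EuclideanSpace ℝ (Fin n)) (g : G) :
    invDeriv Y (L ∘ f) g = L (invDeriv Y f g) := by
  rw [invDeriv_eq_fderiv hf, invDeriv_eq_fderiv (L.contMDiff.comp hf)]
  have hd : DifferentiableAt ℝ (fun v => f (g * (extChartAt (𝓡 n) (1 : G)).symm v))
      (extChartAt (𝓡 n) (1 : G) 1) := by
    refine ((contMDiffAt_iff_contDiffAt (n := 1)).1 ?_).differentiableAt one_ne_zero
    refine (hf _).comp _ (((contMDiff_mul_left_infty g _).of_le (by simp)).comp _ ?_)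
    have : IsManifold (𝓡 n) 1 G := IsManifold.of_le (n := ∞) (by simp)
    exact (contMDiffOn_extChartAt_symm 1).contMDiffAt (extChartAt_target_mem_nhds 1)
  exact congrArg (fun T => T Y) (L.hasFDerivAt.comp _ hd.hasFDerivAt).fderiv

/-- Both projections and their sum are linear maps applied to the single function `(f, k)`. -/
theorem invDeriv_add {f k : G → F} (hf : ContMDiff (𝓡 n) 𝓘(ℝ, F) 1 f)
    (hk : ContMDiff (𝓡 n) 𝓘(ℝ, F) 1 k) (Y : EuclideanSpace ℝ (Fin n)) (g : G) :
    invDeriv Y (f + k) g = invDeriv Y f g + invDeriv Y k g := by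
  have hp := hf.prodMk_space hk
  have h1 := invDeriv_clm_comp (ContinuousLinearMap.fst ℝ F F) hp Y g
  have h2 := invDeriv_clm_comp (ContinuousLinearMap.snd ℝ F F) hp Y g
  have h3 := invDeriv_clm_comp
    (ContinuousLinearMap.fst ℝ F F + ContinuousLinearMap.snd ℝ F F) hp Y g
  simp only [add_apply, ContinuousLinearMap.coe_fst',
    ContinuousLinearMap.coe_snd'] at h1 h2 h3
  refine h3.trans ?_
  rw [← h1, ← h2]
  rfl

/-- Derivation along a left-invariant vector field, on smooth functions. -/
def invDerivL (Y : EuclideanSpace ℝ (Fin n)) : Smooth n G →ₗ[ℂ] Smooth n G where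
  toFun f := ⟨invDeriv Y f, contMDiff_invDeriv f.2 Y⟩
  map_add' f k := Subtype.ext <| funext <|
    invDeriv_add (ContMDiff.of_le f.2 (by simp)) (ContMDiff.of_le k.2 (by simp)) Y
  map_smul' c f := Subtype.ext <| funext <|
    invDeriv_clm_comp (c • ContinuousLinearMap.id ℝ ℂ : ℂ →L[ℝ] ℂ)
      (ContMDiff.of_le f.2 (by simp)) Y

theorem invDerivL_bracket (b : Module.Basis (Fin n) ℝ (GroupLieAlgebra (𝓡 n) G)) (p q : Fin n) :
    invDerivL (b p) * invDerivL (b q) - invDerivL (b q) * invDerivL (b p) =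
      ∑ i, (structConst b p q i : ℂ) • (invDerivL (b i) : Module.End ℂ (Smooth n G)) := by
  ext f g
  have h1 := invDeriv_bracket f.2 (b p) (b q) g
  have h2 : invDeriv (⁅b p, b q⁆ : GroupLieAlgebra (𝓡 n) G) (f : G → ℂ) g =
      ∑ i, structConst b p q i • invDeriv (b i) (f : G → ℂ) g := by
    conv_lhs => rw [← b.sum_repr ⁅b p, b q⁆]
    simp only [invDeriv, dirDeriv]
    rw [map_sum]
    simp_rw [map_smul]
    rfl
  rw [h2] at h1
  simp only [LinearMap.sum_apply, Submodule.coe_sum, Finset.sum_apply]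
  refine h1.trans ?_
  simp [invDerivL]

end InvDeriv

/-! ### Smearing along the action -/

section Action

variable {n : ℕ} {G : Type*} [TopologicalSpace G] [ChartedSpace (EuclideanSpace ℝ (Fin n)) G]
  [Group G] {A : Type*} [CStarAlgebra A] {α : G →* (A ≃⋆ₐ[ℂ] A)}

theorem infGen_eq_dirDeriv (X : GroupLieAlgebra (𝓡 n) G) (a : C1 n α) :
    infGen α X a = dirDeriv (fun g => α g (a : A)) (1 : G) X := rfl

variable [LieGroup (𝓡 n) ∞ G]

theorem contMDiff_inv_mul {F : Type*} [NormedAddCommGroup F] [NormedSpace ℝ F] {f : G → F}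
    (hf : ContMDiff (𝓡 n) 𝓘(ℝ, F) 1 f) :
    ContMDiff ((𝓡 n).prod (𝓡 n)) 𝓘(ℝ, F) 1 fun p : G × G => f (p.2⁻¹ * p.1) := by
  have : LieGroup (𝓡 n) 1 G := LieGroup.of_le (n := ∞) (by simp)
  exact hf.comp (contMDiff_snd.inv.mul contMDiff_fst)

theorem contMDiff_action_mul (a : C1 n α) :
    ContMDiff ((𝓡 n).prod (𝓡 n)) 𝓘(ℝ, A) 1 fun p : G × G => α (p.1 * p.2) (a : A) := by
  have hmul : ContMDiff ((𝓡 n).prod (𝓡 n)) (𝓡 n) 1 fun p : G × G => p.1 * p.2 :=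
    (contMDiff_mul (𝓡 n) ∞).of_le (by simp)
  exact ContMDiff.comp (g := fun g : G => α g (a : A)) a.2 hmul

theorem continuous_dirDeriv_action (a : C1 n α) (X : EuclideanSpace ℝ (Fin n)) :
    Continuous fun g : G => dirDeriv (fun h => α (h * g) (a : A)) (1 : G) X := by
  have : IsManifold (𝓡 n) 1 G := IsManifold.of_le (n := ∞) (by simp)
  have h1 := continuous_slice (continuousOn_fderiv_extChartAt (contMDiff_action_mul a) (1 : G))
    (mem_extChartAt_target 1)
  have h2 : (fun g : G => dirDeriv (fun h => α (h * g) (a : A)) (1 : G) X) = fun g => fderiv ℝ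
      (fun v => α ((extChartAt (𝓡 n) (1 : G)).symm v * g) (a : A)) (extChartAt (𝓡 n) (1 : G) 1) X := by
    funext g
    refine dirDeriv_eq_fderiv ?_ X
    exact (((contMDiff_action_mul a).comp (contMDiff_id.prodMk contMDiff_const)) 1).mdifferentiableAt
      one_ne_zero
  rw [h2]
  exact h1.clm_apply continuous_const

end Action

section Smear

variable {n : ℕ} {G : Type*} [TopologicalSpace G] [ChartedSpace (EuclideanSpace ℝ (Fin n)) G]
  [Group G] [LieGroup (𝓡 n) ∞ G] [CompactSpace G] [MeasurableSpace G] [BorelSpace G]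
  {A : Type*} [CStarAlgebra A] (μ : Measure G) [IsProbabilityMeasure μ]
  {α : G →* (A ≃⋆ₐ[ℂ] A)}

theorem integrable_inv_smul (f : Smooth n G) {D : G → A} (hD : Continuous D) :
    Integrable (fun g => (f : G → ℂ) g⁻¹ • D g) μ := by
  have : IsTopologicalGroup G := topologicalGroup_of_lieGroup (𝓡 n) ∞
  have hf : Continuous (f : G → ℂ) := ContMDiff.continuous f.2
  exact integrable_of_continuous_compact (by fun_prop)

/-- The element `∫ f(g⁻¹) α_g(a) dg`, for a smooth function `f`. -/
def smear (hα : ∀ a : A, Continuous fun g : G => α g a) (a : A) : Smooth n G →ₗ[ℂ] A where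
  toFun f := ∫ g, (f : G → ℂ) g⁻¹ • α g a ∂μ
  map_add' f k := by
    rw [← integral_add (integrable_inv_smul μ f (hα a)) (integrable_inv_smul μ k (hα a))]
    simp [add_smul]
  map_smul' c f := by
    simp [mul_smul, integral_smul]

variable (hα : ∀ a : A, Continuous fun g : G => α g a)

theorem smear_apply (a : A) (f : Smooth n G) :
    smear μ hα a f = ∫ g, (f : G → ℂ) g⁻¹ • α g a ∂μ := rfl

theorem action_smear (a : A) (f : Smooth n G) (h : G) :
    α h (smear μ hα a f) = ∫ g, (f : G → ℂ) g⁻¹ • α (h * g) a ∂μ := by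
  rw [smear_apply]
  refine ((autCLM (α h)).integral_comp_comm (integrable_inv_smul μ f (hα a))).symm.trans ?_
  simp

variable [μ.IsHaarMeasure]

/-- Translation of the Haar integral moves `h` from the orbit of `a` to the function `f`. The result
is therefore smooth in `h` even when the orbit of `a` is only continuous. -/
theorem action_smear' (a : A) (f : Smooth n G) (h : G) :
    α h (smear μ hα a f) = ∫ g, (f : G → ℂ) (g⁻¹ * h) • α g a ∂μ := by
  have : IsTopologicalGroup G := topologicalGroup_of_lieGroup (𝓡 n) ∞
  rw [action_smear, ← integral_mul_left_eq_self (μ := μ)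
    (fun g => (f : G → ℂ) (g⁻¹ * h) • α g a) h]
  simp

/-- The derivative falls on `f`, as a left-invariant derivation, with `a` arbitrary. -/
theorem smear_mem_C1_and (a : A) (f : Smooth n G) :
    ∃ hm : smear μ hα a f ∈ C1 n α, ∀ X : GroupLieAlgebra (𝓡 n) G,
      infGen α X ⟨smear μ hα a f, hm⟩ = smear μ hα a (invDerivL X f) := by
  have : IsManifold (𝓡 n) 1 G := IsManifold.of_le (n := ∞) (by simp)
  let b : G → ℂ →L[ℝ] A := fun g => (ContinuousLinearMap.lsmul ℝ ℂ).flip (α g a)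
  have hb : Continuous b := (ContinuousLinearMap.continuous _).comp (hα a)
  have hb' : ∀ g z, b g z = z • α g a := fun g z => rfl
  have hf : ContMDiff (𝓡 n) 𝓘(ℝ, ℂ) 1 (f : G → ℂ) := ContMDiff.of_le f.2 (by simp)
  have h := contMDiff_integral_and_mfderiv (μ := μ) (contMDiff_inv_mul hf) hb
  simp only [hb'] at h
  have e : (fun h => α h (smear μ hα a f)) = fun h => ∫ g, (f : G → ℂ) (g⁻¹ * h) • α g a ∂μ :=
    funext fun h => action_smear' μ hα a f h
  refine ⟨?_, fun X => ?_⟩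
  · change ContMDiff (𝓡 n) 𝓘(ℝ, A) 1 (fun h => α h (smear μ hα a f))
    rw [e]
    exact h.1
  · rw [infGen_eq_dirDeriv]
    change dirDeriv (fun h => α h (smear μ hα a f)) (1 : G) X = _
    rw [e]
    exact h.2 1 X

/-- `smear` as a map into the algebra of `C¹` elements. -/
def smearC1 (a : A) : Smooth n G →ₗ[ℂ] C1 n α :=
  (smear μ hα a).codRestrict (Subalgebra.toSubmodule (C1 n α)) fun f => (smear_mem_C1_and μ hα a f).1

@[simp] theorem coe_smearC1 (a : A) (f : Smooth n G) :
    (smearC1 μ hα a f : A) = smear μ hα a f := rfl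

theorem infGen_smearC1 (X : GroupLieAlgebra (𝓡 n) G) (a : A) (f : Smooth n G) :
    infGen α X (smearC1 μ hα a f) = smear μ hα a (invDerivL X f) :=
  (smear_mem_C1_and μ hα a f).2 X

/-- For `a` of class `C¹` the derivative can also be put on the orbit of `a`. In this form `f` is
not differentiated, so an approximate identity recovers `∂_X(a)`. -/
theorem infGen_smearC1_of_mem (X : GroupLieAlgebra (𝓡 n) G) (a : C1 n α) (f : Smooth n G) :
    infGen α X (smearC1 μ hα (a : A) f) =
      ∫ g, (f : G → ℂ) g⁻¹ • dirDeriv (fun h => α (h * g) (a : A)) (1 : G) X ∂μ := by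
  have : IsManifold (𝓡 n) 1 G := IsManifold.of_le (n := ∞) (by simp)
  have : IsTopologicalGroup G := topologicalGroup_of_lieGroup (𝓡 n) ∞
  have hf : Continuous (f : G → ℂ) := ContMDiff.continuous f.2
  let b : G → A →L[ℝ] A := fun g => ContinuousLinearMap.lsmul ℝ ℂ ((f : G → ℂ) g⁻¹)
  have hb : Continuous b := (ContinuousLinearMap.continuous _).comp (hf.comp continuous_inv)
  have hb' : ∀ g x, b g x = (f : G → ℂ) g⁻¹ • x := fun g z => rfl
  have h := (contMDiff_integral_and_mfderiv (μ := μ) (contMDiff_action_mul a) hb).2 1 X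
  simp only [hb'] at h
  rw [← h, infGen_eq_dirDeriv]
  congr 1
  funext g
  exact action_smear μ hα _ f g

/-- Simultaneous approximation of finitely many continuous functions at the identity. -/
theorem exists_smooth_approx [T2Space G] {ι : Type*} [Finite ι] {D : ι → G → A}
    (hD : ∀ i, Continuous (D i)) {ε : ℝ} (hε : 0 < ε) :
    ∃ f : Smooth n G, ∀ i, ‖∫ g, (f : G → ℂ) g⁻¹ • D i g ∂μ - D i 1‖ ≤ ε := by
  have : IsTopologicalGroup G := topologicalGroup_of_lieGroup (𝓡 n) ∞
  have : IsManifold (𝓡 n) ∞ G := inferInstance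
  have hW : {g : G | ∀ i, ‖D i g⁻¹ - D i 1‖ < ε} ∈ 𝓝 (1 : G) := by
    have : ∀ᶠ g in 𝓝 (1 : G), ∀ i, ‖D i g⁻¹ - D i 1‖ < ε := by
      rw [eventually_all]
      intro i
      have hc : Continuous fun g : G => ‖D i g⁻¹ - D i 1‖ := by have := hD i; fun_prop
      exact hc.continuousAt.eventually_lt continuousAt_const (by simpa using hε)
    exact this
  -- `f` is a bump function supported where all the `D i g⁻¹` are `ε`-close to `D i 1`, normalised
  -- by its integral over inverses.
  obtain ⟨χ, -, hχ⟩ := (SmoothBumpFunction.nhds_basis_support (I := 𝓡 n) hW).mem_iff.1 hW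
  have hχc : Continuous fun g : G => χ g⁻¹ := χ.continuous.comp continuous_inv
  have hi : Integrable (fun g : G => χ g⁻¹) μ := integrable_of_continuous_compact hχc
  have hpos : 0 < ∫ g : G, χ g⁻¹ ∂μ := by
    refine (integral_pos_iff_support_of_nonneg (fun g => χ.nonneg) hi).2 ?_
    refine (hχc.isOpen_support).measure_pos μ ⟨1, ?_⟩
    simp
  set c := ∫ g : G, χ g⁻¹ ∂μ with hc
  have hsm : ContMDiff (𝓡 n) 𝓘(ℝ, ℂ) ∞ fun g : G => ((c⁻¹ * χ g : ℝ) : ℂ) :=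
    (Complex.ofRealCLM.comp (c⁻¹ • ContinuousLinearMap.id ℝ ℝ)).contMDiff.comp χ.contMDiff
  refine ⟨⟨_, hsm⟩, fun i => ?_⟩
  have h1 : ∫ g : G, c⁻¹ * χ g⁻¹ ∂μ = 1 := by
    rw [integral_const_mul, ← hc, inv_mul_cancel₀ hpos.ne']
  have h2 : ∫ g : G, (c⁻¹ * χ g⁻¹) • D i 1 ∂μ = D i 1 := by
    rw [integral_smul_const, h1, one_smul]
  simp only [Complex.coe_smul]
  conv_lhs => rw [← h2]
  have hχ' : Continuous fun g : G => c⁻¹ * χ g⁻¹ := continuous_const.mul hχc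
  have i1 : Integrable (fun g : G => (c⁻¹ * χ g⁻¹) • D i g) μ :=
    integrable_of_continuous_compact (hχ'.smul (hD i))
  have i2 : Integrable (fun g : G => (c⁻¹ * χ g⁻¹) • D i 1) μ :=
    integrable_of_continuous_compact (hχ'.smul continuous_const)
  rw [← integral_sub i1 i2]
  have h3 : ∫ g : G, (c⁻¹ * χ g⁻¹) * ε ∂μ = ε := by
    rw [integral_mul_const, h1, one_mul]
  conv_rhs => rw [← h3]
  refine norm_integral_le_of_norm_le
    (integrable_of_continuous_compact (hχ'.mul continuous_const))
    (ae_of_all _ fun g => ?_)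
  have h0 : 0 ≤ c⁻¹ * χ g⁻¹ := mul_nonneg (inv_nonneg.2 hpos.le) χ.nonneg
  rw [← smul_sub, norm_smul, Real.norm_of_nonneg h0]
  by_cases hg : χ g⁻¹ = 0
  · simp [hg]
  · have := hχ (show g⁻¹ ∈ Function.support χ from hg) i
    rw [inv_inv] at this
    gcongr

/-- A single `f` must serve for the coefficients and all their derivatives; `none` indexes the orbit
itself, `some j` its derivative in the direction `X j`. -/
theorem exists_smearC1_approx [T2Space G] {ι κ : Type*} [Finite ι] [Finite κ]
    (a : ι → C1 n α) (X : κ → GroupLieAlgebra (𝓡 n) G) {ε : ℝ} (hε : 0 < ε) :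
    ∃ f : Smooth n G, ∀ i, ‖(smearC1 μ hα (a i : A) f : A) - a i‖ ≤ ε ∧
      ∀ j, ‖infGen α (X j) (smearC1 μ hα (a i : A) f) - infGen α (X j) (a i)‖ ≤ ε := by
  obtain ⟨f, hf⟩ := exists_smooth_approx (n := n) μ (ι := ι × Option κ)
    (D := fun p g => p.2.elim (α g (a p.1 : A))
      fun j => dirDeriv (fun h => α (h * g) (a p.1 : A)) (1 : G) (X j)) (by
      rintro ⟨i, _ | j⟩
      · exact hα _
      · exact continuous_dirDeriv_action _ _) hε
  refine ⟨f, fun i => ⟨?_, fun j => ?_⟩⟩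
  · simpa [smear_apply] using hf (i, none)
  · rw [infGen_smearC1_of_mem, infGen_eq_dirDeriv]
    simpa using hf (i, some j)

end Smear

theorem dense_C1 {n : ℕ} {G : Type*} [TopologicalSpace G]
    [ChartedSpace (EuclideanSpace ℝ (Fin n)) G] [Group G] [LieGroup (𝓡 n) ∞ G] [CompactSpace G]
    [T2Space G] {A : Type*} [CStarAlgebra A] {α : G →* (A ≃⋆ₐ[ℂ] A)}
    (hα : ∀ a : A, Continuous fun g : G => α g a) :
    Dense (C1 n α : Set A) := by
  have : IsTopologicalGroup G := topologicalGroup_of_lieGroup (𝓡 n) ∞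
  borelize G
  obtain ⟨μ, _, _, -⟩ := exists_bi_invariant_probability G
  intro a
  rw [Metric.mem_closure_iff]
  intro ε hε
  obtain ⟨f, hf⟩ := exists_smooth_approx (n := n) μ (ι := Unit) (D := fun _ g => α g a) (fun _ => hα a)
    (half_pos hε)
  refine ⟨smear μ hα a f, (smearC1 μ hα a f).2, ?_⟩
  have := hf ()
  rw [dist_comm, dist_eq_norm]
  simp only [map_one] at this
  exact this.trans_lt (half_lt_self hε)

/-! ### Canonical anticommutation relations on forms -/

section Anticommutation

variable {n : ℕ} {M N : Type*} [AddCommGroup M] [Module ℂ M] [AddCommGroup N] [Module ℂ N]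

/-- The sign `(-1) ^ #{i ∈ S | i < j}`. -/
def sgn (j : Fin n) (S : Finset (Fin n)) : ℤ := (-1) ^ (S.filter (· < j)).card

theorem sgn_insert {p q : Fin n} {S : Finset (Fin n)} (hp : p ∉ S) :
    sgn q (insert p S) = if p < q then -sgn q S else sgn q S := by
  unfold sgn
  rw [Finset.filter_insert]
  split_ifs with h
  · rw [Finset.card_insert_of_notMem (by simp [hp]), pow_succ]
    simp
  · rfl

theorem sgn_erase {p q : Fin n} {S : Finset (Fin n)} (hp : p ∈ S) :
    sgn q (S.erase p) = if p < q then -sgn q S else sgn q S := by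
  have h := sgn_insert (q := q) (Finset.notMem_erase p S)
  rw [Finset.insert_erase hp] at h
  split_ifs at h ⊢ <;> simp [h]

theorem sgn_mul_self (j : Fin n) (S : Finset (Fin n)) : sgn j S * sgn j S = 1 := by
  unfold sgn
  rw [← mul_pow]
  simp

theorem wedge_apply (j : Fin n) (η : Forms n M) (S : Finset (Fin n)) :
    wedge j η S = if j ∈ S then sgn j S • η (S.erase j) else 0 := rfl

theorem removeFactor_apply (j : Fin n) (η : Forms n M) (S : Finset (Fin n)) :
    removeFactor j η S = if j ∈ S then 0 else sgn j S • η (insert j S) := rfl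

theorem wedge_wedge (p q : Fin n) (η : Forms n M) :
    wedge p (wedge q η) = -wedge q (wedge p η) := by
  funext S
  simp only [wedge_apply, Pi.neg_apply, Finset.mem_erase]
  rcases eq_or_ne p q with rfl | hpq
  · simp
  by_cases hp : p ∈ S <;> by_cases hq : q ∈ S
  · simp only [hp, hq, hpq, hpq.symm, sgn_erase hp, sgn_erase hq, ne_eq, not_false_eq_true,
      and_self, if_true, smul_smul, Finset.erase_right_comm (a := p) (b := q)]
    rcases lt_or_gt_of_ne hpq with h | h
    · simp [h, h.not_gt, mul_comm]
    · simp [h, h.not_gt, mul_comm]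
  all_goals simp [hp, hq]

theorem removeFactor_removeFactor (p q : Fin n) (η : Forms n M) :
    removeFactor p (removeFactor q η) = -removeFactor q (removeFactor p η) := by
  funext S
  simp only [removeFactor_apply, Pi.neg_apply, Finset.mem_insert]
  rcases eq_or_ne p q with rfl | hpq
  · simp
  by_cases hp : p ∈ S <;> by_cases hq : q ∈ S
  · simp [hp, hq]
  · simp [hp, hq]
  · simp [hp, hq]
  simp only [hp, hq, hpq, hpq.symm, sgn_insert hp, sgn_insert hq, or_self, if_false, smul_smul,
    Finset.insert_comm p q]
  rcases lt_or_gt_of_ne hpq with h | h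
  · simp [h, h.not_gt, mul_comm]
  · simp [h, h.not_gt, mul_comm]

/-- For `i ≠ p` the two orders of inserting and erasing differ by exactly one sign, since precisely
one of `i < p`, `p < i` holds. -/
theorem removeFactor_wedge (i p : Fin n) (η : Forms n M) :
    removeFactor i (wedge p η) = (if i = p then η else 0) - wedge p (removeFactor i η) := by
  funext S
  rcases eq_or_ne i p with rfl | hip
  · by_cases hi : i ∈ S
    · simp [removeFactor_apply, wedge_apply, hi, sgn_erase hi, smul_smul, sgn_mul_self]
    · simp [removeFactor_apply, wedge_apply, hi, sgn_insert hi, smul_smul, sgn_mul_self]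
  · by_cases hi : i ∈ S <;> by_cases hp : p ∈ S
    · simp [removeFactor_apply, wedge_apply, hi, hp, hip]
    · simp [removeFactor_apply, wedge_apply, hi, hp, hip]
    · simp only [removeFactor_apply, wedge_apply, hi, hp, hip, hip.symm, if_true, if_false,
        Finset.mem_insert, Finset.mem_erase, or_true, and_false, sgn_insert hi, sgn_erase hp,
        Pi.sub_apply, Pi.zero_apply, zero_sub, smul_smul, Finset.erase_insert_of_ne hip]
      rcases lt_or_gt_of_ne hip with h | h
      · simp [h, h.not_gt, mul_comm]
      · simp [h, h.not_gt, mul_comm]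
    · simp [removeFactor_apply, wedge_apply, hi, hp, hip, hip.symm]

theorem wedge_compLeft (f : M →ₗ[ℂ] N) (j : Fin n) (η : Forms n M) :
    wedge j (f.compLeft (Finset (Fin n)) η) = f.compLeft (Finset (Fin n)) (wedge j η) := by
  funext S
  by_cases h : j ∈ S <;> simp [wedge_apply, h]

theorem removeFactor_compLeft (f : M →ₗ[ℂ] N) (j : Fin n) (η : Forms n M) :
    removeFactor j (f.compLeft (Finset (Fin n)) η) =
      f.compLeft (Finset (Fin n)) (removeFactor j η) := by
  funext S
  by_cases h : j ∈ S <;> simp [removeFactor_apply, h]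

end Anticommutation

/-! ### The Chevalley–Eilenberg identity `d² = 0` -/

section SquareZero

variable {J R : Type*} [Fintype J] [Ring R] [Algebra ℂ R]

theorem sum_sum_eq_zero_of_antisymm (f : J → J → R) (hf : ∀ i j, f i j = -f j i) :
    ∑ i, ∑ j, f i j = 0 := by
  have h : ∑ i, ∑ j, f i j = -∑ i, ∑ j, f i j := by
    conv_lhs => rw [Finset.sum_comm]
    rw [← Finset.sum_neg_distrib]
    refine Finset.sum_congr rfl fun i _ => ?_
    rw [← Finset.sum_neg_distrib]
    exact Finset.sum_congr rfl fun j _ => hf j i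
  have h2 : (2 : ℂ) • ∑ i, ∑ j, f i j = 0 := by
    rw [two_smul]; nth_rewrite 1 [h]; simp
  exact (smul_eq_zero.1 h2).resolve_left two_ne_zero

theorem sum_sum_sum_eq_zero_of_cyclic (f : J → J → J → R)
    (hf : ∀ i j k, f i j k + f j k i + f k i j = 0) : ∑ i, ∑ j, ∑ k, f i j k = 0 := by
  have h0 : ∀ f : J → J → J → R, ∑ i, ∑ j, ∑ k, f j k i = ∑ i, ∑ j, ∑ k, f i j k := by
    intro f
    rw [Finset.sum_comm]
    exact Finset.sum_congr rfl fun j _ => Finset.sum_comm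
  have h1 := h0 f
  have h2 := (h0 fun i j k => f k i j).symm
  have h3 : (3 : ℂ) • ∑ i, ∑ j, ∑ k, f i j k = 0 := by
    have : (3 : ℂ) • ∑ i, ∑ j, ∑ k, f i j k =
        ∑ i, ∑ j, ∑ k, (f i j k + f j k i + f k i j) := by
      simp only [Finset.sum_add_distrib, h1, h2]
      module
    rw [this]
    simp [hf]
  exact (smul_eq_zero.1 h3).resolve_left three_ne_zero

/-- The abstract form of `d² = 0` for the Chevalley–Eilenberg differential: `T` and `ι` satisfy the
canonical anticommutation relations, and `L` is a representation commuting with them. -/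
theorem chevalleyEilenberg_sq [DecidableEq J] (T ι L : J → R) (c : J → J → J → ℂ)
    (hTT : ∀ p q, T p * T q = -(T q * T p)) (hιι : ∀ p q, ι p * ι q = -(ι q * ι p))
    (hιT : ∀ i p, ι i * T p = (if i = p then 1 else 0) - T p * ι i)
    (hLT : ∀ i p, L i * T p = T p * L i) (hLι : ∀ i p, L i * ι p = ι p * L i)
    (hc : ∀ p q i, c p q i = -c q p i)
    (hJ : ∀ p q s k, ∑ i, (c p q i * c i s k + c q s i * c i p k + c s p i * c i q k) = 0)
    (hL : ∀ p q, L p * L q - L q * L p = ∑ i, c p q i • L i) :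
    (∑ j, T j * L j - (1 / 2 : ℂ) • ∑ i, ∑ p, ∑ q, c p q i • (T p * (T q * ι i))) *
      (∑ j, T j * L j - (1 / 2 : ℂ) • ∑ i, ∑ p, ∑ q, c p q i • (T p * (T q * ι i))) = 0 := by
  -- With `D = ∑ T_j L_j` and `N = ∑ E_i ι_i` the operator is `D - N`. The `E_i` are even, so they
  -- commute with the `T_j` and with each other, and `F i k` is the contraction of `E k` by `ι i`.
  -- It remains to see that `D² = DN + ND` and `N² = 0`.
  set E : J → R := fun i => (1 / 2 : ℂ) • ∑ p, ∑ q, c p q i • (T p * T q) with hE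
  set F : J → J → R := fun i k => ∑ s, c i s k • T s with hF
  have hN : (1 / 2 : ℂ) • ∑ i, ∑ p, ∑ q, c p q i • (T p * (T q * ι i)) = ∑ i, E i * ι i := by
    simp only [hE, Finset.smul_sum, Finset.sum_mul, smul_mul_assoc, mul_assoc]
  have hTTT : ∀ j p q, T j * (T p * T q) = T p * T q * T j := fun j p q => by
    rw [← mul_assoc, hTT j p, neg_mul, mul_assoc, hTT j q, mul_neg, neg_neg, mul_assoc]
  have hxE : ∀ x, (∀ p q, x * (T p * T q) = T p * T q * x) → ∀ i, x * E i = E i * x :=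
    fun x hx i => by
      simp only [hE, Finset.smul_sum, Finset.sum_mul, Finset.mul_sum, smul_mul_assoc,
        mul_smul_comm, hx]
  have hTE : ∀ j i, T j * E i = E i * T j := fun j => hxE _ (hTTT j)
  have hEE : ∀ i k, E i * E k = E k * E i := fun i k =>
    (hxE (E k) (fun p q => by rw [← mul_assoc, ← hTE, mul_assoc, ← hTE, mul_assoc]) i).symm
  have hLE : ∀ j i, L j * E i = E i * L j := fun j => hxE _ fun p q => by
    rw [← mul_assoc, hLT, mul_assoc, hLT, mul_assoc]
  have hιTT : ∀ i p q, ι i * (T p * T q) =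
      (if i = p then T q else 0) - (if i = q then T p else 0) + T p * T q * ι i := fun i p q => by
    rw [← mul_assoc, hιT, sub_mul, mul_assoc, hιT, mul_sub, ← mul_assoc]
    split_ifs <;> simp <;> abel
  have hιE : ∀ i k, ι i * E k = F i k + E k * ι i := fun i k => by
    have h1 : ι i * E k = (1 / 2 : ℂ) • (∑ s, c i s k • T s - ∑ s, c s i k • T s) + E k * ι i := by
      simp only [hE, mul_smul_comm, Finset.mul_sum, hιTT, smul_add, smul_sub, smul_ite, smul_zero,
        Finset.sum_add_distrib, Finset.sum_sub_distrib, smul_mul_assoc, Finset.sum_mul]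
      rw [Finset.sum_comm (f := fun p q => if i = p then c p q k • T q else 0)]
      simp
    have h2 : ∑ s, c s i k • T s = -∑ s, c i s k • T s := by
      rw [← Finset.sum_neg_distrib]
      exact Finset.sum_congr rfl fun s _ => by rw [hc, neg_smul]
    rw [h1, h2, hF]
    module
  -- Antisymmetry of `T_p T_q` replaces `L_p L_q` by half its commutator.
  have hD2 : (∑ j, T j * L j) * (∑ j, T j * L j) = ∑ i, E i * L i := by
    have e1 : (∑ j, T j * L j) * (∑ j, T j * L j) = ∑ p, ∑ q, T p * T q * (L p * L q) := by
      rw [Finset.sum_mul_sum]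
      refine Finset.sum_congr rfl fun p _ => Finset.sum_congr rfl fun q _ => ?_
      rw [mul_assoc, ← mul_assoc (L p), hLT]; simp only [mul_assoc]
    have e2 : ∑ i, E i * L i = (1 / 2 : ℂ) • ∑ p, ∑ q, T p * T q * (L p * L q - L q * L p) := by
      simp only [hL, hE, Finset.smul_sum, Finset.sum_mul, Finset.mul_sum, smul_mul_assoc,
        mul_smul_comm]
      rw [Finset.sum_comm]
      exact Finset.sum_congr rfl fun p _ => Finset.sum_comm
    have e3 : ∑ p, ∑ q, T p * T q * (L q * L p) = -∑ p, ∑ q, T p * T q * (L p * L q) := by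
      rw [Finset.sum_comm, ← Finset.sum_neg_distrib]
      refine Finset.sum_congr rfl fun p _ => ?_
      rw [← Finset.sum_neg_distrib]
      exact Finset.sum_congr rfl fun q _ => by rw [hTT q p, neg_mul]
    rw [e1, e2]
    simp only [mul_sub, Finset.sum_sub_distrib, e3]
    module
  have hDN : (∑ j, T j * L j) * (∑ i, E i * ι i) + (∑ i, E i * ι i) * (∑ j, T j * L j) =
      ∑ i, E i * L i := by
    have e1 : ∀ i j, T j * L j * (E i * ι i) + E i * ι i * (T j * L j) =
        if i = j then E i * L j else 0 := fun i j => by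
      have : T j * L j * (E i * ι i) = E i * (T j * ι i) * L j := by
        rw [mul_assoc, ← mul_assoc (L j), hLE, mul_assoc (E i), hLι, ← mul_assoc, hTE]
        simp only [mul_assoc]
      rw [this, mul_assoc (E i) (ι i), ← mul_assoc (ι i), hιT, mul_assoc (E i), ← mul_add,
        ← add_mul]
      split_ifs <;> simp
    rw [Finset.sum_mul_sum, Finset.sum_mul_sum, Finset.sum_comm, ← Finset.sum_add_distrib]
    simp only [← Finset.sum_add_distrib, e1]
    simp
  -- `T_p T_q T_s` is invariant under cyclic permutations, so the coefficients may be summed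
  -- cyclically, and the Jacobi identity kills them.
  have hEF : ∀ k, ∑ i, E i * F i k = 0 := fun k => by
    have e1 : ∑ i, E i * F i k = (1 / 2 : ℂ) • ∑ p, ∑ q, ∑ s,
        (∑ i, c p q i * c i s k) • (T p * T q * T s) := by
      simp only [hE, hF, smul_mul_assoc, Finset.sum_mul]
      simp only [Finset.smul_sum, Finset.mul_sum, mul_smul_comm, Finset.sum_smul, smul_smul]
      refine Finset.sum_comm.trans (Finset.sum_congr rfl fun p _ => ?_)
      refine Finset.sum_comm.trans (Finset.sum_congr rfl fun q _ => ?_)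
      refine Finset.sum_comm.trans (Finset.sum_congr rfl fun s _ => ?_)
      refine Finset.sum_congr rfl fun i _ => ?_
      congr 1
    rw [e1, sum_sum_sum_eq_zero_of_cyclic, smul_zero]
    intro p q s
    have c1 : T q * T s * T p = T p * T q * T s := by rw [← hTTT, mul_assoc]
    have c2 : T s * T p * T q = T p * T q * T s := by rw [mul_assoc, hTTT]
    rw [c1, c2, ← add_smul, ← add_smul, ← Finset.sum_add_distrib, ← Finset.sum_add_distrib, hJ,
      zero_smul]
  -- Moving `ι_i` past `E_k` leaves `E_i F_{ik} ι_k`, which sums to zero by `hEF`, and `E_i E_k ι_i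
  -- ι_k`, antisymmetric in `i, k`.
  have hN2 : (∑ i, E i * ι i) * (∑ i, E i * ι i) = 0 := by
    have e1 : ∀ i k, E i * ι i * (E k * ι k) = E i * F i k * ι k + E i * E k * (ι i * ι k) :=
      fun i k => by
        rw [mul_assoc, ← mul_assoc (ι i), hιE, add_mul, mul_add]
        simp only [mul_assoc]
    rw [Finset.sum_mul_sum]
    simp only [e1, Finset.sum_add_distrib]
    rw [sum_sum_eq_zero_of_antisymm (fun i k => E i * E k * (ι i * ι k)), add_zero,
      Finset.sum_comm]
    · simp only [← Finset.sum_mul, hEF]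
      simp
    · intro i k
      rw [hEE, hιι, mul_neg]
  rw [hN, sub_mul, mul_sub, mul_sub, hD2, hN2, sub_zero]
  rw [← hDN]
  abel

end SquareZero

/-! ### Forms with coefficients in smooth functions -/

section SmoothForms

variable {n : ℕ} {G : Type*} [TopologicalSpace G] [ChartedSpace (EuclideanSpace ℝ (Fin n)) G]
  [Group G] [LieGroup (𝓡 n) ∞ G]

theorem structConst_antisymm (b : Module.Basis (Fin n) ℝ (GroupLieAlgebra (𝓡 n) G))
    (p q i : Fin n) : structConst b p q i = -structConst b q p i := by
  have : LieGroup (𝓡 n) (minSmoothness ℝ 3) G :=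
    LieGroup.of_le (n := ∞) (by simpa using ENat.LEInfty.out)
  unfold structConst
  rw [← lie_skew (b p) (b q), map_neg]
  rfl

theorem structConst_jacobi (b : Module.Basis (Fin n) ℝ (GroupLieAlgebra (𝓡 n) G))
    (p q s k : Fin n) :
    ∑ i, (structConst b p q i * structConst b i s k + structConst b q s i * structConst b i p k +
      structConst b s p i * structConst b i q k) = 0 := by
  have : LieGroup (𝓡 n) (minSmoothness ℝ 3) G :=
    LieGroup.of_le (n := ∞) (by simpa using ENat.LEInfty.out)
  have h : ∀ p q s, b.repr ⁅⁅b p, b q⁆, b s⁆ k = ∑ i, structConst b p q i * structConst b i s k := by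
    intro p q s
    conv_lhs => rw [← b.sum_repr ⁅b p, b q⁆]
    rw [sum_lie]
    simp [structConst]
  simp only [Finset.sum_add_distrib, ← h]
  rw [← Finsupp.add_apply, ← Finsupp.add_apply, ← map_add, ← map_add]
  have : ⁅⁅b p, b q⁆, b s⁆ + ⁅⁅b q, b s⁆, b p⁆ + ⁅⁅b s, b p⁆, b q⁆ = 0 := by
    have := lie_jacobi (b p) (b q) (b s)
    rw [← lie_skew ⁅b p, b q⁆, ← lie_skew ⁅b q, b s⁆, ← lie_skew ⁅b s, b p⁆]
    rw [← neg_eq_zero, ← this]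
    abel
  rw [this]
  simp

/-- The exterior derivative on smooth functions with values in the exterior algebra, for the right
translation action. -/
def smoothD (b : Module.Basis (Fin n) ℝ (GroupLieAlgebra (𝓡 n) G)) :
    Module.End ℂ (Forms n (Smooth n G)) :=
  (∑ j, wedge j * (invDerivL (b j)).compLeft (Finset (Fin n)))
    - (1 / 2 : ℂ) • ∑ i, ∑ p, ∑ q, (structConst b p q i : ℂ) •
        (wedge p * (wedge q * removeFactor i))

theorem smoothD_smoothD (b : Module.Basis (Fin n) ℝ (GroupLieAlgebra (𝓡 n) G))
    (η : Forms n (Smooth n G)) : smoothD b (smoothD b η) = 0 := by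
  have h := chevalleyEilenberg_sq (J := Fin n) (R := Module.End ℂ (Forms n (Smooth n G)))
    (fun j => wedge j) (fun j => removeFactor j)
    (fun j => (invDerivL (b j)).compLeft (Finset (Fin n))) (fun p q i => (structConst b p q i : ℂ))
    (fun p q => LinearMap.ext fun η => wedge_wedge p q η)
    (fun p q => LinearMap.ext fun η => removeFactor_removeFactor p q η)
    (fun i p => LinearMap.ext fun η => by
      simp only [Module.End.mul_apply, LinearMap.sub_apply, removeFactor_wedge]
      split_ifs <;> rfl)
    (fun i p => LinearMap.ext fun η => (wedge_compLeft (invDerivL (b i)) p η).symm)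
    (fun i p => LinearMap.ext fun η => (removeFactor_compLeft (invDerivL (b i)) p η).symm)
    (fun p q i => by rw [structConst_antisymm]; simp)
    (fun p q s k => by exact_mod_cast structConst_jacobi b p q s k)
    (fun p q => LinearMap.ext fun η => funext fun S => by
      have := congrArg (fun f : Module.End ℂ (Smooth n G) => f (η S)) (invDerivL_bracket b p q)
      simpa using this)
  exact congrArg (fun f : Module.End ℂ (Forms n (Smooth n G)) => f η) h

end SmoothForms

/-! ### Exterior derivatives of smeared forms -/

section SmearForms

variable {n : ℕ} {G : Type*} [TopologicalSpace G] [ChartedSpace (EuclideanSpace ℝ (Fin n)) G]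
  [Group G] [LieGroup (𝓡 n) ∞ G] [CompactSpace G] [MeasurableSpace G] [BorelSpace G]
  {A : Type*} [CStarAlgebra A] (μ : Measure G) [IsProbabilityMeasure μ] [μ.IsHaarMeasure]
  {α : G →* (A ≃⋆ₐ[ℂ] A)} (hα : ∀ a : A, Continuous fun g : G => α g a)

/-- Smearing acts on coefficients only, so it commutes with the operations on the exterior factor,
and it carries the invariant derivations to the generators. -/
theorem extD_compLeft_smearC1 (b : Module.Basis (Fin n) ℝ (GroupLieAlgebra (𝓡 n) G)) (a : A)
    (η : Forms n (Smooth n G)) :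
    extD α b ((smearC1 μ hα a).compLeft (Finset (Fin n)) η) =
      (smear μ hα a).compLeft (Finset (Fin n)) (smoothD b η) := by
  have h1 : ∀ j, (infGen α (b j)).compLeft (Finset (Fin n))
      ((smearC1 μ hα a).compLeft (Finset (Fin n)) η) =
      (smear μ hα a).compLeft (Finset (Fin n)) ((invDerivL (b j)).compLeft (Finset (Fin n)) η) :=
    fun j => funext fun S => infGen_smearC1 μ hα (b j) a (η S)
  have h2 : (C1 n α).val.toLinearMap.compLeft (Finset (Fin n))
      ((smearC1 μ hα a).compLeft (Finset (Fin n)) η) =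
      (smear μ hα a).compLeft (Finset (Fin n)) η := rfl
  simp only [extD, smoothD, LinearMap.sub_apply, LinearMap.sum_apply, LinearMap.smul_apply,
    LinearMap.comp_apply, Module.End.mul_apply, h1, h2, wedge_compLeft, removeFactor_compLeft,
    map_sub, map_sum, map_smul]

/-- The form with coefficients `smear (a S) f`. -/
def smearForm (a : Forms n A) (f : Smooth n G) : Forms n (C1 n α) :=
  fun S => smearC1 μ hα (a S) f

/-- This is the usable form of `d² = 0`: `d` of a smeared form is the smearing of a smooth form,
hence stays in the core, and applying `d` once more gives the smearing of `smoothD` squared. -/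
theorem exists_extD_smearForm (b : Module.Basis (Fin n) ℝ (GroupLieAlgebra (𝓡 n) G))
    (a : Forms n A) (f : Smooth n G) :
    ∃ ζ : Forms n (C1 n α), extD α b (smearForm μ hα a f) =
      (C1 n α).val.toLinearMap.compLeft (Finset (Fin n)) ζ ∧ extD α b ζ = 0 := by
  classical
  have e : smearForm μ hα a f = ∑ S, (smearC1 μ hα (a S)).compLeft (Finset (Fin n))
      (Pi.single S f) := by
    funext S
    rw [Finset.sum_apply, Finset.sum_eq_single S]
    · simp [smearForm]
    · intro T _ hT
      simp [Pi.single_eq_of_ne hT.symm]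
    · simp
  refine ⟨∑ S, (smearC1 μ hα (a S)).compLeft (Finset (Fin n)) (smoothD b (Pi.single S f)), ?_, ?_⟩
  · rw [e, map_sum, map_sum]
    exact Finset.sum_congr rfl fun S _ => extD_compLeft_smearC1 μ hα b (a S) _
  · rw [map_sum]
    refine Finset.sum_eq_zero fun S _ => ?_
    rw [extD_compLeft_smearC1, smoothD_smoothD, map_zero]

end SmearForms

/-- The invariant state of an ergodic action of a compact Lie group is a trace. -/
theorem rsq_eq_lsq {n : ℕ} {G : Type*} [TopologicalSpace G]
    [ChartedSpace (EuclideanSpace ℝ (Fin n)) G] [Group G] [LieGroup (𝓡 n) ∞ G] [CompactSpace G]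
    [T2Space G] {A : Type*} [CStarAlgebra A] [PartialOrder A] [StarOrderedRing A]
    {α : G →* (A ≃⋆ₐ[ℂ] A)} {φ : A →ₚ[ℂ] ℂ} (hα : ∀ a : A, Continuous fun g : G => α g a)
    (herg : ∀ a : A, (∀ g : G, α g a = a) → ∃ c : ℂ, a = c • (1 : A))
    (hφ : φ 1 = 1) (hinv : ∀ (g : G) (a : A), φ (α g a) = φ a) (x : A) :
    rsq φ x = lsq φ x := by
  have : IsTopologicalGroup G := topologicalGroup_of_lieGroup (𝓡 n) ∞
  have : SecondCountableTopology G :=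
    ChartedSpace.secondCountable_of_sigmaCompact (EuclideanSpace ℝ (Fin n)) G
  borelize G
  obtain ⟨μ, _, _, _⟩ := exists_bi_invariant_probability G
  have hle : ∀ y : A, rsq φ y ≤ lsq φ y := by
    intro y
    refine (dense_C1 (n := n) hα).induction (P := fun y => rsq φ y ≤ lsq φ y) (fun y hy => ?_)
      (isClosed_le (continuous_rsq φ) (continuous_lsq φ)) y
    exact rsq_le_lsq_of_mem_C1 (μ := μ) hα hφ hinv (integral_action_eq hα herg hφ hinv) ⟨y, hy⟩
  refine le_antisymm (hle x) ?_
  -- The adjoint exchanges the two seminorms.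
  simpa [lsq, rsq] using hle (star x)

theorem confFactor_mul_neg {A : Type*} [CStarAlgebra A] (n : ℕ) (h : A) (u : ℝ)
    (k : ℕ) :
    confFactor n h u k * confFactor n h (-u) k = 1 := by
  unfold confFactor
  let _ : NormedAlgebra ℚ A := NormedAlgebra.restrictScalars ℚ ℝ A
  rw [mul_neg, Complex.ofReal_neg, neg_smul, ← NormedSpace.exp_add_of_commute
    (Commute.neg_right (Commute.refl _)), add_neg_cancel, NormedSpace.exp_zero]

theorem confFactor_neg_mul {A : Type*} [CStarAlgebra A] (n : ℕ) (h : A) (u : ℝ)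
    (k : ℕ) :
    confFactor n h (-u) k * confFactor n h u k = 1 := by
  simpa using confFactor_mul_neg n h (-u) k

/-! ### Right multiplication on the GNS space of a trace -/

section RightMultiplication

variable {A : Type*} [CStarAlgebra A] [PartialOrder A] [StarOrderedRing A] (φ : A →ₚ[ℂ] ℂ)

theorem norm_toPreGNS (a : A) : ‖φ.toPreGNS a‖ = √(lsq φ a) := rfl

theorem norm_toPreGNS_le (hφ : φ 1 = 1) (a : A) : ‖φ.toPreGNS a‖ ≤ ‖a‖ := by
  have h : lsq φ a ≤ ‖a‖ ^ 2 * 1 := by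
    have := rsq_mul_le φ 1 (star a)
    simpa [lsq, rsq, hφ] using this
  rw [norm_toPreGNS]
  exact Real.sqrt_le_iff.2 ⟨norm_nonneg a, by simpa using h⟩

/-- The map from `A` to the GNS space of a state. -/
def gnsMap (hφ : φ 1 = 1) : A →L[ℂ] φ.GNS :=
  (UniformSpace.Completion.toComplL (𝕜 := ℂ) (E := φ.PreGNS)).comp
    (φ.toPreGNS.toLinearMap.mkContinuous 1 fun a => by
      simpa using norm_toPreGNS_le φ hφ a)

variable {φ} (htr : ∀ x, rsq φ x = lsq φ x)

include htr in
-- The trace property turns the GNS norm into the right seminorm, for which right multiplication is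
-- bounded.
theorem norm_toPreGNS_mul_le (x a : A) : ‖φ.toPreGNS (x * a)‖ ≤ ‖a‖ * ‖φ.toPreGNS x‖ := by
  rw [norm_toPreGNS, norm_toPreGNS, ← htr, ← htr]
  refine Real.sqrt_le_iff.2 ⟨by positivity, ?_⟩
  rw [mul_pow, Real.sq_sqrt (rsq_nonneg φ x)]
  exact rsq_mul_le φ x a

/-- Right multiplication on the GNS space of a trace. -/
def rightMul (a : A) : φ.GNS →L[ℂ] φ.GNS :=
  ((φ.toPreGNS.toLinearMap ∘ₗ LinearMap.mulRight ℂ a ∘ₗ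
    φ.ofPreGNS.toLinearMap).mkContinuous ‖a‖ fun x =>
      norm_toPreGNS_mul_le htr (φ.ofPreGNS x) a).completion

theorem rightMul_coe (a x : A) :
    rightMul htr a (φ.toPreGNS x : φ.GNS) = (φ.toPreGNS (x * a) : φ.GNS) := by
  simp only [rightMul, ContinuousLinearMap.completion_apply_coe]
  rfl

theorem rightMul_rightMul {a b : A} (hab : a * b = 1) (x : φ.GNS) :
    rightMul htr b (rightMul htr a x) = x := by
  induction x using UniformSpace.Completion.induction_on with
  | hp => exact isClosed_eq (by fun_prop) continuous_id
  | ih x =>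
    obtain ⟨x, rfl⟩ := φ.toPreGNS.surjective x
    rw [rightMul_coe, rightMul_coe, mul_assoc, hab, mul_one]

/-- Right multiplication by an invertible element on the GNS space of a trace. -/
def rightMulEquiv {a b : A} (hab : a * b = 1) (hba : b * a = 1) : φ.GNS ≃L[ℂ] φ.GNS :=
  ContinuousLinearEquiv.equivOfInverse (rightMul htr a) (rightMul htr b)
    (rightMul_rightMul htr hab) (rightMul_rightMul htr hba)

/-- The extension of `confK` to a bounded invertible operator. -/
def confKEquiv (n : ℕ) (h : A) (u : ℝ) : Hil n φ ≃L[ℂ] Hil n φ :=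
  (PiLp.continuousLinearEquiv 2 ℂ (fun _ : Finset (Fin n) => φ.GNS)).trans
    ((ContinuousLinearEquiv.piCongrRight fun S : Finset (Fin n) =>
      rightMulEquiv htr (confFactor_mul_neg n h u S.card) (confFactor_neg_mul n h u S.card)).trans
        (PiLp.continuousLinearEquiv 2 ℂ (fun _ : Finset (Fin n) => φ.GNS)).symm)

theorem confKEquiv_apply (n : ℕ) (h : A) (u : ℝ) (x : Hil n φ) (S : Finset (Fin n)) :
    confKEquiv htr n h u x S = rightMulEquiv htr (confFactor_mul_neg n h u S.card)
      (confFactor_neg_mul n h u S.card) (x S) := rfl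

theorem cls_apply (n : ℕ) (η : Forms n A) (S : Finset (Fin n)) :
    cls n φ η S = (φ.toPreGNS (η S) : φ.GNS) := rfl

theorem confKEquiv_cls (n : ℕ) (h : A) (u : ℝ) (η : Forms n A) :
    confKEquiv htr n h u (cls n φ η) = cls n φ (confK n h u η) := by
  ext S
  rw [confKEquiv_apply, cls_apply, cls_apply]
  exact rightMul_coe htr _ _

theorem confKEquiv_mem_degreePart_iff (n : ℕ) (h : A) (u : ℝ) (k : ℕ) (x : Hil n φ) :
    confKEquiv htr n h u x ∈ degreePart n φ k ↔ x ∈ degreePart n φ k := by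
  refine forall₂_congr fun S _ => ?_
  rw [confKEquiv_apply]
  exact map_eq_zero_iff _ (ContinuousLinearEquiv.injective _)

end RightMultiplication

/-! ### Formal adjoints and closability -/

section Derivation

open scoped InnerProductSpace

variable {n : ℕ} {G : Type*} [TopologicalSpace G] [ChartedSpace (EuclideanSpace ℝ (Fin n)) G]
  [Group G] {A : Type*} [CStarAlgebra A] {α : G →* (A ≃⋆ₐ[ℂ] A)}

theorem star_mem_C1 {a : A} (ha : a ∈ C1 n α) : star a ∈ C1 n α := by
  change ContMDiff (𝓡 n) 𝓘(ℝ, A) 1 (fun g : G => α g (star a))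
  have h := (starL' ℝ : A ≃L[ℝ] A).contDiff.contMDiff.comp ha (n := 1)
  simpa [Function.comp_def, map_star] using h

theorem infGen_star (X : GroupLieAlgebra (𝓡 n) G) (a : C1 n α) :
    infGen α X ⟨star (a : A), star_mem_C1 a.2⟩ = star (infGen α X a) := by
  have ha := (a.2.mdifferentiableAt (x := 1) one_ne_zero).hasMFDerivAt
  have h := (((starL' ℝ : A ≃L[ℝ] A) : A →L[ℝ] A).hasMFDerivAt.comp (1 : G) ha).mfderiv
  have e : (fun g : G => α g (star (a : A))) =
      ((starL' ℝ : A ≃L[ℝ] A) : A →L[ℝ] A) ∘ fun g : G => α g (a : A) := by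
    funext g; simp [map_star]
  change mfderiv (𝓡 n) 𝓘(ℝ, A) (fun g : G => α g (star (a : A))) 1 X = _
  rw [e, h]
  rfl

theorem infGen_mul (X : GroupLieAlgebra (𝓡 n) G) (a b : C1 n α) :
    infGen α X (a * b) = infGen α X a * b + a * infGen α X b := by
  have ha := (a.2.mdifferentiableAt (x := 1) one_ne_zero).hasMFDerivAt
  have hb := (b.2.mdifferentiableAt (x := 1) one_ne_zero).hasMFDerivAt
  have h := (ha.mul' hb).mfderiv
  have e : (fun g : G => α g ((a * b : C1 n α) : A)) =
      (fun g : G => α g (a : A)) * fun g : G => α g (b : A) := by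
    funext g; simp
  change mfderiv (𝓡 n) 𝓘(ℝ, A) (fun g : G => α g ((a * b : C1 n α) : A)) 1 X = _
  rw [e, h]
  have h1 : ∀ c : A, α (1 : G) c = c := fun c => by simp
  change α (1 : G) (a : A) * infGen α X b + infGen α X a * α (1 : G) (b : A) = _
  rw [h1, h1, add_comm]

variable [PartialOrder A] [StarOrderedRing A] {φ : A →ₚ[ℂ] ℂ}

/-- `φ` is constant along orbits. -/
theorem map_infGen_eq_zero (hinv : ∀ (g : G) (a : A), φ (α g a) = φ a)
    (X : GroupLieAlgebra (𝓡 n) G) (a : C1 n α) : φ (infGen α X a) = 0 := by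
  have ha := (a.2.mdifferentiableAt (x := 1) one_ne_zero).hasMFDerivAt
  have h := ((((posCLM φ).restrictScalars ℝ).hasMFDerivAt).comp (1 : G) ha).mfderiv
  have e : (((posCLM φ).restrictScalars ℝ) ∘ fun g : G => α g (a : A)) = fun _ => φ (a : A) := by
    funext g; simp [hinv]
  rw [e] at h
  have h2 := congrArg (fun L : TangentSpace (𝓡 n) (1 : G) →L[ℝ] ℂ => L X) h
  rw [mfderiv_const] at h2
  exact h2.symm

/-- Integration by parts: `φ` annihilates `∂_X(b⋆ a)`, and `∂_X` is a ⋆-derivation. -/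
theorem map_star_mul_infGen (hinv : ∀ (g : G) (a : A), φ (α g a) = φ a)
    (X : GroupLieAlgebra (𝓡 n) G) (b a : C1 n α) :
    φ (star (b : A) * infGen α X a) = φ (star (-infGen α X b) * a) := by
  have h := map_infGen_eq_zero hinv X (⟨star (b : A), star_mem_C1 b.2⟩ * a)
  rw [infGen_mul, infGen_star, map_add] at h
  rw [star_neg, neg_mul, map_neg]
  exact eq_neg_of_add_eq_zero_right h

theorem inner_cls_single (T : Finset (Fin n)) (c : A) (ξ : Forms n A) :
    ⟪cls n φ (Pi.single T c), cls n φ ξ⟫_ℂ = φ (star c * ξ T) := by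
  rw [PiLp.inner_apply, Finset.sum_eq_single T]
  · rw [cls_apply, cls_apply, Pi.single_eq_same, UniformSpace.Completion.inner_coe]
    rfl
  · intro S _ hS
    rw [cls_apply, Pi.single_eq_of_ne hS, map_zero, UniformSpace.Completion.coe_zero, inner_zero_left]
  · simp

theorem inner_cls_single_left (T : Finset (Fin n)) (c : A) (y : Hil n φ) :
    ⟪cls n φ (Pi.single T c), y⟫_ℂ = ⟪(φ.toPreGNS c : φ.GNS), y T⟫_ℂ := by
  rw [PiLp.inner_apply, Finset.sum_eq_single T]
  · rw [cls_apply, Pi.single_eq_same]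
  · intro S _ hS
    rw [cls_apply, Pi.single_eq_of_ne hS, map_zero, UniformSpace.Completion.coe_zero, inner_zero_left]
  · simp

variable (n φ α) in
/-- The operators on forms that have a formal adjoint. -/
def adjointable : Submodule ℂ (Forms n (C1 n α) →ₗ[ℂ] Forms n A) where
  carrier := {D | ∀ (S : Finset (Fin n)) (b : C1 n α), ∃ v : Hil n φ, ∀ η,
    φ (star (b : A) * D η S) =
      ⟪v, cls n φ ((C1 n α).val.toLinearMap.compLeft (Finset (Fin n)) η)⟫_ℂ}
  zero_mem' S b := ⟨0, fun η => by simp⟩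
  add_mem' {D E} hD hE S b := by
    obtain ⟨v, hv⟩ := hD S b
    obtain ⟨w, hw⟩ := hE S b
    exact ⟨v + w, fun η => by rw [inner_add_left, ← hv, ← hw]; simp [mul_add]⟩
  smul_mem' c D hD S b := by
    obtain ⟨v, hv⟩ := hD S b
    exact ⟨star c • v, fun η => by rw [inner_smul_left, ← hv]; simp⟩

theorem wedge_comp_mem_adjointable {D : Forms n (C1 n α) →ₗ[ℂ] Forms n A}
    (hD : D ∈ adjointable n α φ) (j : Fin n) : wedge j ∘ₗ D ∈ adjointable n α φ := by
  intro S b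
  obtain ⟨v, hv⟩ := hD (S.erase j) b
  by_cases h : j ∈ S
  · refine ⟨((sgn j S : ℤ) : ℂ) • v, fun η => ?_⟩
    rw [inner_smul_left, ← hv, LinearMap.comp_apply, wedge_apply, if_pos h,
      ← Int.cast_smul_eq_zsmul ℂ, mul_smul_comm, map_smul]
    simp
  · exact ⟨0, fun η => by simp [wedge_apply, h]⟩

theorem removeFactor_comp_mem_adjointable {D : Forms n (C1 n α) →ₗ[ℂ] Forms n A}
    (hD : D ∈ adjointable n α φ) (j : Fin n) : removeFactor j ∘ₗ D ∈ adjointable n α φ := by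
  intro S b
  obtain ⟨v, hv⟩ := hD (insert j S) b
  by_cases h : j ∈ S
  · exact ⟨0, fun η => by simp [removeFactor_apply, h]⟩
  · refine ⟨((sgn j S : ℤ) : ℂ) • v, fun η => ?_⟩
    rw [inner_smul_left, ← hv, LinearMap.comp_apply, removeFactor_apply, if_neg h,
      ← Int.cast_smul_eq_zsmul ℂ, mul_smul_comm, map_smul]
    simp

theorem extD_mem_adjointable (hinv : ∀ (g : G) (a : A), φ (α g a) = φ a)
    (b : Module.Basis (Fin n) ℝ (GroupLieAlgebra (𝓡 n) G)) : extD α b ∈ adjointable n α φ := by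
  have h1 : ∀ X, (infGen α X).compLeft (Finset (Fin n)) ∈ adjointable n α φ := fun X S c =>
    ⟨cls n φ (Pi.single S (-infGen α X c)), fun η => by
      rw [inner_cls_single]
      exact map_star_mul_infGen hinv X c (η S)⟩
  have h2 : (C1 n α).val.toLinearMap.compLeft (Finset (Fin n)) ∈ adjointable n α φ := fun S c =>
    ⟨cls n φ (Pi.single S (c : A)), fun η => by rw [inner_cls_single]⟩
  refine sub_mem (sum_mem fun j _ => wedge_comp_mem_adjointable (h1 _) j)
    (Submodule.smul_mem _ _ (sum_mem fun i _ => sum_mem fun p _ => sum_mem fun q _ =>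
      Submodule.smul_mem _ _ ?_))
  exact wedge_comp_mem_adjointable (wedge_comp_mem_adjointable
    (removeFactor_comp_mem_adjointable h2 i) q) p

variable [LieGroup (𝓡 n) ∞ G] [CompactSpace G] [T2Space G]

/-- The `C¹` elements are norm dense in `A`, whose classes are dense in the GNS space. -/
theorem eq_zero_of_inner_cls_single (hα : ∀ a : A, Continuous fun g : G => α g a)
    (hφ : φ 1 = 1) {y : Hil n φ}
    (hy : ∀ (S : Finset (Fin n)) (b : C1 n α), ⟪cls n φ (Pi.single S (b : A)), y⟫_ℂ = 0) :
    y = 0 := by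
  ext S
  have hd : DenseRange fun a : A => (φ.toPreGNS a : φ.GNS) :=
    UniformSpace.Completion.denseRange_coe.comp φ.toPreGNS.surjective.denseRange
      (UniformSpace.Completion.continuous_coe _)
  have h1 : ∀ a : A, ⟪(φ.toPreGNS a : φ.GNS), y S⟫_ℂ = 0 := fun a =>
    (dense_C1 (n := n) hα).induction (P := fun a => ⟪(φ.toPreGNS a : φ.GNS), y S⟫_ℂ = 0)
      (fun b hb => by rw [← inner_cls_single_left]; exact hy S ⟨b, hb⟩)
      (isClosed_eq ((gnsMap φ hφ).continuous.inner continuous_const) continuous_const) a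
  have h2 : ∀ z : φ.GNS, ⟪z, y S⟫_ℂ = 0 := fun z =>
    hd.induction_on (p := fun z => ⟪z, y S⟫_ℂ = 0) z
      (isClosed_eq (continuous_id.inner continuous_const) continuous_const) h1
  exact inner_self_eq_zero.1 (h2 _)

/-- The adjoint relation is a closed condition on pairs, so it passes from the graph to its closure.
On the graph itself the conclusion says that the operator is well defined on classes; on the closure
it says that it is closable. -/
theorem snd_eq_zero_of_mem_closure_formGraph (hα : ∀ a : A, Continuous fun g : G => α g a)
    (hφ : φ 1 = 1) {D : Forms n (C1 n α) →ₗ[ℂ] Forms n A} (hD : D ∈ adjointable n α φ)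
    (p : Hil n φ × Hil n φ) (hp : p ∈ (formGraph φ D).topologicalClosure) (h0 : p.1 = 0) :
    p.2 = 0 := by
  refine eq_zero_of_inner_cls_single hα hφ fun S b => ?_
  obtain ⟨v, hv⟩ := hD S b
  have hc : IsClosed {p : Hil n φ × Hil n φ | ⟪cls n φ (Pi.single S (b : A)), p.2⟫_ℂ = ⟪v, p.1⟫_ℂ} :=
    isClosed_eq (continuous_const.inner continuous_snd) (continuous_const.inner continuous_fst)
  have hsub : (formGraph φ D : Set (Hil n φ × Hil n φ)) ⊆
      {p | ⟪cls n φ (Pi.single S (b : A)), p.2⟫_ℂ = ⟪v, p.1⟫_ℂ} := by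
    rintro _ ⟨η, rfl⟩
    exact (inner_cls_single S (b : A) (D η)).trans (hv η)
  have := closure_minimal hsub hc hp
  rw [Set.mem_ofPred_eq, h0, inner_zero_right] at this
  exact this

end Derivation

/-! ### Unbounded operators intertwined by a bounded isomorphism -/

section UnboundedOperators

variable {V : Type*} [AddCommGroup V] [Module ℂ V]

theorem mem_opKer_iff (T : V →ₗ.[ℂ] V) (x : V) : x ∈ opKer T ↔ (x, 0) ∈ T.graph := by
  rw [LinearPMap.mem_graph_iff]
  constructor
  · rintro ⟨y, hy, rfl⟩
    exact ⟨y, rfl, hy⟩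
  · rintro ⟨y, rfl, hy⟩
    exact ⟨y, hy, rfl⟩

theorem mem_opRange_iff (T : V →ₗ.[ℂ] V) (y : V) : y ∈ opRange T ↔ ∃ x, (x, y) ∈ T.graph := by
  constructor
  · rintro ⟨x, rfl⟩
    exact ⟨x, T.mem_graph x⟩
  · rintro ⟨x, hx⟩
    obtain ⟨z, -, hz⟩ := (LinearPMap.mem_graph_iff T).1 hx
    exact ⟨z, hz⟩

variable [TopologicalSpace V]

/-- Two operators are intertwined by `K` if `K × K` carries the graph of the first onto the graph of
the second. -/
def Intertwines (K : V ≃L[ℂ] V) (S T : V →ₗ.[ℂ] V) : Prop :=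
  ∀ x y, (x, y) ∈ S.graph ↔ (K x, K y) ∈ T.graph

variable {K : V ≃L[ℂ] V} {S T : V →ₗ.[ℂ] V}

theorem Intertwines.map_opKer (h : Intertwines K S T) :
    (opKer S).map (K : V →ₗ[ℂ] V) = opKer T := by
  ext x
  rw [Submodule.mem_map]
  constructor
  · rintro ⟨y, hy, rfl⟩
    rw [mem_opKer_iff] at hy ⊢
    simpa using (h _ _).1 hy
  · intro hx
    refine ⟨K.symm x, ?_, by simp⟩
    rw [mem_opKer_iff] at hx ⊢
    rw [h]
    simpa using hx

theorem Intertwines.map_opRange (h : Intertwines K S T) :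
    (opRange S).map (K : V →ₗ[ℂ] V) = opRange T := by
  ext x
  rw [Submodule.mem_map]
  constructor
  · rintro ⟨y, hy, rfl⟩
    rw [mem_opRange_iff] at hy ⊢
    obtain ⟨z, hz⟩ := hy
    exact ⟨_, (h _ _).1 hz⟩
  · intro hx
    refine ⟨K.symm x, ?_, by simp⟩
    rw [mem_opRange_iff] at hx ⊢
    obtain ⟨z, hz⟩ := hx
    refine ⟨K.symm z, ?_⟩
    rw [h]
    simpa using hz

variable [ContinuousAdd V] [ContinuousSMul ℂ V]

theorem isClosable_of_snd_eq_zero {T : V →ₗ.[ℂ] V}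
    (h : ∀ p ∈ T.graph.topologicalClosure, p.1 = 0 → p.2 = 0) : T.IsClosable :=
  ⟨_, (Submodule.toLinearPMap_graph_eq _ h).symm⟩

/-- `K × K` is a homeomorphism, and preimages under a homeomorphism commute with closure. -/
theorem mem_closure_iff_of_map {Γ Δ : Submodule ℂ (V × V)}
    (h : ∀ x y, (x, y) ∈ Γ ↔ (K x, K y) ∈ Δ) (x y : V) :
    (x, y) ∈ Γ.topologicalClosure ↔ (K x, K y) ∈ Δ.topologicalClosure := by
  let L : V × V ≃ₜ V × V := K.toHomeomorph.prodCongr K.toHomeomorph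
  have h1 : (Γ : Set (V × V)) = L ⁻¹' Δ := by
    ext ⟨x, y⟩
    exact h x y
  change (x, y) ∈ closure (Γ : Set (V × V)) ↔ L (x, y) ∈ closure (Δ : Set (V × V))
  rw [h1, ← L.preimage_closure]
  rfl

theorem Intertwines.isClosable (h : Intertwines K S T) (hS : S.IsClosable) : T.IsClosable := by
  refine isClosable_of_snd_eq_zero fun p hp h0 => ?_
  have h1 := (mem_closure_iff_of_map h (K.symm p.1) (K.symm p.2)).2 (by simpa using hp)
  rw [hS.graph_closure_eq_closure_graph] at h1
  have := S.closure.graph_fst_eq_zero_snd h1 (by simp [h0])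
  simpa using this

theorem Intertwines.closure (h : Intertwines K S T) (hS : S.IsClosable) :
    Intertwines K S.closure T.closure := by
  intro x y
  rw [← hS.graph_closure_eq_closure_graph, ← (h.isClosable hS).graph_closure_eq_closure_graph]
  exact mem_closure_iff_of_map h x y

theorem map_topologicalClosure (K : V ≃L[ℂ] V) (W : Submodule ℂ V) :
    W.topologicalClosure.map (K : V →ₗ[ℂ] V) = (W.map (K : V →ₗ[ℂ] V)).topologicalClosure :=
  SetLike.coe_injective (K.toHomeomorph.image_closure W)

theorem Intertwines.map_closure_opRange (h : Intertwines K S T) :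
    (opRange S).topologicalClosure.map (K : V →ₗ[ℂ] V) = (opRange T).topologicalClosure := by
  rw [map_topologicalClosure, h.map_opRange]

end UnboundedOperators

/-! ### Homogeneous forms -/

section Degrees

variable {n : ℕ}

/-- The form `η` has only components of degree `d`. -/
def IsHomogeneous {M : Type*} [Zero M] (η : Forms n M) (d : ℤ) : Prop :=
  ∀ S : Finset (Fin n), (S.card : ℤ) ≠ d → η S = 0

variable {M : Type*} [AddCommGroup M] [Module ℂ M] {η : Forms n M} {d : ℤ}

theorem IsHomogeneous.wedge (h : IsHomogeneous η d) (j : Fin n) :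
    IsHomogeneous (wedge j η) (d + 1) := by
  intro S hS
  rw [wedge_apply]
  split_ifs with hj
  · rw [h, smul_zero]
    rw [Finset.card_erase_of_mem hj]
    have := Finset.card_pos.2 ⟨j, hj⟩
    omega
  · rfl

/-- Degrees are integers so that `d - 1` makes sense at `d = 0`, where the conclusion is that the
result vanishes. -/
theorem IsHomogeneous.removeFactor (h : IsHomogeneous η d) (j : Fin n) :
    IsHomogeneous (removeFactor j η) (d - 1) := by
  intro S hS
  rw [removeFactor_apply]
  split_ifs with hj
  · rfl
  · rw [h, smul_zero]
    rw [Finset.card_insert_of_notMem hj]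
    omega

variable {G : Type*} [TopologicalSpace G] [ChartedSpace (EuclideanSpace ℝ (Fin n)) G] [Group G]
  {A : Type*} [CStarAlgebra A] {α : G →* (A ≃⋆ₐ[ℂ] A)}

theorem IsHomogeneous.compLeft {N : Type*} [AddCommGroup N] [Module ℂ N] (h : IsHomogeneous η d)
    (f : M →ₗ[ℂ] N) : IsHomogeneous (f.compLeft (Finset (Fin n)) η) d := fun S hS => by
  simp [h S hS]

theorem IsHomogeneous.extD {η : Forms n (C1 n α)} (h : IsHomogeneous η d)
    (b : Module.Basis (Fin n) ℝ (GroupLieAlgebra (𝓡 n) G)) :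
    IsHomogeneous (extD α b η) (d + 1) := by
  intro S hS
  have h1 : ∀ j, ConformalComplex.wedge j ((infGen α (b j)).compLeft (Finset (Fin n)) η) S = 0 :=
    fun j => (h.compLeft _).wedge j S hS
  have h2 : ∀ i p q, ConformalComplex.wedge p (ConformalComplex.wedge q
      (ConformalComplex.removeFactor i
        ((C1 n α).val.toLinearMap.compLeft (Finset (Fin n)) η))) S = 0 :=
    fun i p q => ((((h.compLeft _).removeFactor i).wedge q).wedge p) S (by omega)
  simp [ConformalComplex.extD, h1, h2]

end Degrees

/-! ### Approximating `d η` by derivatives of smeared forms -/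

section Approximation

variable {n : ℕ} {G : Type*} [TopologicalSpace G] [ChartedSpace (EuclideanSpace ℝ (Fin n)) G]
  [Group G] {A : Type*} [CStarAlgebra A] {α : G →* (A ≃⋆ₐ[ℂ] A)}
  (b : Module.Basis (Fin n) ℝ (GroupLieAlgebra (𝓡 n) G))

theorem continuous_wedge (j : Fin n) : Continuous (wedge j : Forms n A → Forms n A) := by
  refine continuous_pi fun S => ?_
  simp only [wedge_apply]
  split_ifs <;> fun_prop

theorem continuous_removeFactor (j : Fin n) :
    Continuous (removeFactor j : Forms n A → Forms n A) := by
  refine continuous_pi fun S => ?_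
  simp only [removeFactor_apply]
  split_ifs <;> fun_prop

/-- The coefficients of a form together with their first derivatives. -/
def jet (η : Forms n (C1 n α)) : Option (Fin n) → Forms n A
  | none => (C1 n α).val.toLinearMap.compLeft (Finset (Fin n)) η
  | some j => (infGen α (b j)).compLeft (Finset (Fin n)) η

/-- The exterior derivative as a function of the first jet. -/
def jetD (ξ : Option (Fin n) → Forms n A) : Forms n A :=
  (∑ j, wedge j (ξ (some j)))
    - (1 / 2 : ℂ) • ∑ i, ∑ p, ∑ q, (structConst b p q i : ℂ) •
        (wedge p (wedge q (removeFactor i (ξ none))))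

theorem jetD_jet (η : Forms n (C1 n α)) : jetD b (jet b η) = extD α b η := by
  simp [jetD, jet, extD]

theorem continuous_jetD : Continuous (jetD (A := A) b) := by
  have h1 : ∀ j, Continuous fun ξ : Option (Fin n) → Forms n A => wedge j (ξ (some j)) :=
    fun j => (continuous_wedge j).comp (continuous_apply _)
  have h2 : ∀ i p q, Continuous fun ξ : Option (Fin n) → Forms n A =>
      wedge p (wedge q (removeFactor i (ξ none))) := fun i p q =>
    (continuous_wedge p).comp ((continuous_wedge q).comp
      ((continuous_removeFactor i).comp (continuous_apply _)))
  have h3 : Continuous fun ξ : Option (Fin n) → Forms n A => ∑ i, ∑ p, ∑ q,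
      (structConst b p q i : ℂ) • (wedge p (wedge q (removeFactor i (ξ none)))) :=
    continuous_finsetSum _ fun i _ => continuous_finsetSum _ fun p _ =>
      continuous_finsetSum _ fun q _ => (h2 i p q).const_smul (structConst b p q i : ℂ)
  exact (continuous_finsetSum _ fun j _ => h1 j).sub (h3.const_smul (1 / 2 : ℂ))

/-- `d` is not continuous in the coefficients, but it is a continuous function of the first jet, and
smearing approximates the whole jet at once. -/
theorem extD_mem_closure [LieGroup (𝓡 n) ∞ G] [CompactSpace G] [T2Space G]
    [MeasurableSpace G] [BorelSpace G] (μ : Measure G) [IsProbabilityMeasure μ] [μ.IsHaarMeasure]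
    (hα : ∀ a : A, Continuous fun g : G => α g a) (η : Forms n (C1 n α)) :
    extD α b η ∈ closure (Set.range fun f : Smooth n G =>
      extD α b (smearForm μ hα (fun S => (η S : A)) f)) := by
  have h : jet b η ∈ closure (Set.range fun f : Smooth n G =>
      jet b (smearForm μ hα (fun S => (η S : A)) f)) := by
    rw [Metric.mem_closure_iff]
    intro ε hε
    obtain ⟨f, hf⟩ := exists_smearC1_approx μ hα η b (half_pos hε)
    refine ⟨_, ⟨f, rfl⟩, ?_⟩
    rw [dist_comm]
    refine lt_of_le_of_lt ?_ (half_lt_self hε)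
    refine (dist_pi_le_iff (half_pos hε).le).2 fun o => (dist_pi_le_iff (half_pos hε).le).2 fun S => ?_
    rw [dist_eq_norm]
    rcases o with _ | j
    · exact (hf S).1
    · exact (hf S).2 j
  rw [← jetD_jet]
  refine map_mem_closure (continuous_jetD b) h ?_
  rintro _ ⟨f, rfl⟩
  exact ⟨f, (jetD_jet b _).symm⟩

end Approximation

theorem confK1_neg {n : ℕ} {G : Type*} [TopologicalSpace G]
    [ChartedSpace (EuclideanSpace ℝ (Fin n)) G] [Group G] {A : Type*} [CStarAlgebra A]
    {α : G →* (A ≃⋆ₐ[ℂ] A)} (h : C1 n α) (u : ℝ) (η : Forms n (C1 n α)) :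
    confK1 α h (-u) (confK1 α h u η) = η := by
  funext S
  apply Subtype.ext
  change (η S : A) * confFactor n (h : A) u S.card * confFactor n (h : A) (-u) S.card = η S
  rw [mul_assoc, confFactor_mul_neg, mul_one]

/-! ### The complex property and the conjugation of graphs -/

section Complex

variable {n : ℕ} {G : Type*} [TopologicalSpace G] [ChartedSpace (EuclideanSpace ℝ (Fin n)) G]
  [Group G] {A : Type*} [CStarAlgebra A] [PartialOrder A] [StarOrderedRing A]
  {α : G →* (A ≃⋆ₐ[ℂ] A)} {φ : A →ₚ[ℂ] ℂ}

theorem continuous_cls (hφ : φ 1 = 1) : Continuous (cls n φ) :=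
  (PiLp.continuous_toLp 2 _).comp
    (continuous_pi fun S => (gnsMap φ hφ).continuous.comp (continuous_apply S))

theorem mem_graph_coreOpDeg_iff {D : Forms n (C1 n α) →ₗ[ℂ] Forms n A} {k : ℕ}
    {p : Hil n φ × Hil n φ} :
    p ∈ (coreOpDeg φ D k).graph ↔ p ∈ (coreOp φ D).graph ∧ p.1 ∈ degreePart n φ k := by
  constructor
  · intro hp
    refine ⟨LinearPMap.le_graph_of_le LinearPMap.domRestrict_le hp, ?_⟩
    obtain ⟨x, hx, -⟩ := (LinearPMap.mem_graph_iff _).1 hp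
    rw [← hx]
    exact x.2.1
  · rintro ⟨hp, hk⟩
    obtain ⟨x, hx, hy⟩ := (LinearPMap.mem_graph_iff _).1 hp
    refine (LinearPMap.mem_graph_iff _).2 ⟨⟨x, ⟨by rwa [hx], x.2⟩⟩, hx, ?_⟩
    rw [← hy]
    exact LinearPMap.domRestrict_apply rfl

theorem coreOpDeg_isClosable {D : Forms n (C1 n α) →ₗ[ℂ] Forms n A}
    (h : (coreOp φ D).IsClosable) (k : ℕ) : (coreOpDeg φ D k).IsClosable :=
  h.leIsClosable LinearPMap.domRestrict_le

theorem isClosed_cocycles {D : Forms n (C1 n α) →ₗ[ℂ] Forms n A}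
    (h : (coreOp φ D).IsClosable) (k : ℕ) : IsClosed (cocycles φ D k : Set (Hil n φ)) := by
  have h1 : (cocycles φ D k : Set (Hil n φ)) =
      (fun x => (x, 0)) ⁻¹' ((coreOpDeg φ D k).closure.graph : Set (Hil n φ × Hil n φ)) := by
    ext x
    exact mem_opKer_iff _ x
  rw [h1]
  exact (coreOpDeg_isClosable h k).closure_isClosed.preimage (by fun_prop)

/-- The kernel of the closed operator is closed, so only `[d η]` for core forms of degree `k` has to
be treated, and these are limits of derivatives of smeared forms, which are cocycles. -/
theorem closedCoboundaries_extD_le (hα : ∀ a : A, Continuous fun g : G => α g a)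
    [LieGroup (𝓡 n) ∞ G] [CompactSpace G] [T2Space G] (hφ : φ 1 = 1)
    (b : Module.Basis (Fin n) ℝ (GroupLieAlgebra (𝓡 n) G))
    (hgraph : (coreOp φ (extD α b)).graph = formGraph φ (extD α b))
    (hcl : (coreOp φ (extD α b)).IsClosable) (k : ℕ) :
    closedCoboundaries φ (extD α b) k ≤ cocycles φ (extD α b) k := by
  rcases k with _ | k
  · exact bot_le
  have : IsTopologicalGroup G := topologicalGroup_of_lieGroup (𝓡 n) ∞
  borelize G
  obtain ⟨μ, _, _, -⟩ := exists_bi_invariant_probability G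
  refine Submodule.topologicalClosure_minimal _ ?_ (isClosed_cocycles hcl _)
  intro y hy
  obtain ⟨x, hx⟩ := (mem_opRange_iff _ _).1 hy
  rw [← (coreOpDeg_isClosable hcl k).graph_closure_eq_closure_graph] at hx
  have hclosed : IsClosed {p : Hil n φ × Hil n φ | p.2 ∈ cocycles φ (extD α b) (k + 1)} :=
    (isClosed_cocycles hcl _).preimage continuous_snd
  refine closure_minimal ?_ hclosed hx
  intro p hp
  obtain ⟨hp, hk⟩ := mem_graph_coreOpDeg_iff.1 hp
  rw [hgraph] at hp
  obtain ⟨η, rfl⟩ := hp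
  -- Only the class of `η` is known to have degree `k`; its other components have zero class.
  -- Truncation leaves the class unchanged, and hence also `[d η]`, because the operator is well
  -- defined on classes.
  let η' : Forms n (C1 n α) := fun S => if S.card = k then η S else 0
  have hη' : IsHomogeneous η' k := fun S hS => if_neg (by exact_mod_cast hS)
  have hcls : cls n φ ((C1 n α).val.toLinearMap.compLeft (Finset (Fin n)) η') =
      cls n φ ((C1 n α).val.toLinearMap.compLeft (Finset (Fin n)) η) := by
    ext S
    by_cases hS : S.card = k
    · simp [cls_apply, η', hS]
    · refine Eq.trans ?_ (hk S hS).symm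
      simp [cls_apply, η', hS, UniformSpace.Completion.coe_zero]
  have hD : cls n φ (extD α b η) = cls n φ (extD α b η') := by
    refine (coreOp φ (extD α b)).mem_graph_snd_inj (x := cls n φ
      ((C1 n α).val.toLinearMap.compLeft (Finset (Fin n)) η))
      (y := cls n φ ((C1 n α).val.toLinearMap.compLeft (Finset (Fin n)) η')) ?_ ?_ hcls.symm
    · rw [hgraph]
      exact ⟨η, rfl⟩
    · rw [hgraph]
      exact ⟨η', rfl⟩
  change cls n φ (extD α b η) ∈ cocycles φ (extD α b) (k + 1)
  rw [hD]
  -- The map to classes is continuous, so it suffices to check the smeared forms.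
  have hclosed' : IsClosed {ξ : Forms n A | cls n φ ξ ∈ cocycles φ (extD α b) (k + 1)} :=
    (isClosed_cocycles hcl _).preimage (continuous_cls hφ)
  refine closure_minimal ?_ hclosed' (extD_mem_closure b μ hα η')
  rintro _ ⟨f, rfl⟩
  obtain ⟨ζ, hζ, hζ0⟩ := exists_extD_smearForm μ hα b (fun S => (η' S : A)) f
  have hhom : IsHomogeneous (smearForm μ hα (fun S => (η' S : A)) f) k := fun S hS => by
    have h0 : (η' S : A) = 0 := by rw [hη' S hS]; rfl
    apply Subtype.ext
    simp [smearForm, h0, smear_apply]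
  refine (mem_opKer_iff _ _).2 (LinearPMap.le_graph_of_le (LinearPMap.le_closure _)
    (mem_graph_coreOpDeg_iff.2 ⟨?_, fun S hS => ?_⟩))
  · rw [hgraph]
    refine ⟨ζ, Prod.ext ?_ ?_⟩
    · exact congrArg (cls n φ) hζ.symm
    · change cls n φ (extD α b ζ) = 0
      rw [hζ0, map_zero]
  · have := hhom.extD b S (by exact_mod_cast hS)
    change cls n φ (extD α b (smearForm μ hα (fun S => (η' S : A)) f)) S = 0
    rw [cls_apply, this, map_zero, UniformSpace.Completion.coe_zero]

/-- `K_u` maps the core onto itself with inverse `K_{-u}`, because the conformal factors are of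
class `C¹`; on the core, `d_u K_u = K_u d`. -/
theorem mem_formGraph_extDConf_iff (htr : ∀ x, rsq φ x = lsq φ x)
    (b : Module.Basis (Fin n) ℝ (GroupLieAlgebra (𝓡 n) G)) (h : C1 n α) (u : ℝ) (x y : Hil n φ) :
    (x, y) ∈ formGraph φ (extD α b) ↔ (confKEquiv htr n (h : A) u x, confKEquiv htr n (h : A) u y) ∈
      formGraph φ (extDConf α b h u) := by
  have hcoe : ∀ (v : ℝ) (η : Forms n (C1 n α)),
      (C1 n α).val.toLinearMap.compLeft (Finset (Fin n)) (confK1 α h v η) =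
        confK n (h : A) v ((C1 n α).val.toLinearMap.compLeft (Finset (Fin n)) η) := fun _ _ => rfl
  constructor
  · rintro ⟨η, hη⟩
    obtain ⟨rfl, rfl⟩ := Prod.ext_iff.1 hη
    refine ⟨confK1 α h u η, Prod.ext ?_ ?_⟩
    · change cls n φ _ = confKEquiv htr n (h : A) u (cls n φ _)
      rw [hcoe, confKEquiv_cls]
    · change cls n φ (confK n (h : A) u (extD α b (confK1 α h (-u) (confK1 α h u η)))) =
        confKEquiv htr n (h : A) u (cls n φ (extD α b η))
      rw [confK1_neg, confKEquiv_cls]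
  · rintro ⟨η, hη⟩
    obtain ⟨h1, h2⟩ := Prod.ext_iff.1 hη
    have e : confK1 α h u (confK1 α h (-u) η) = η := by simpa using confK1_neg h (-u) η
    refine ⟨confK1 α h (-u) η, Prod.ext ?_ ?_⟩
    · apply (confKEquiv htr n (h : A) u).injective
      refine Eq.trans ?_ h1
      change confKEquiv htr n (h : A) u (cls n φ _) = cls n φ _
      rw [confKEquiv_cls, ← hcoe, e]
    · apply (confKEquiv htr n (h : A) u).injective
      refine Eq.trans ?_ h2
      exact confKEquiv_cls htr n (h : A) u _

end Complex

/-! ### Transport of kernels, ranges and cohomology -/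

section Transfer

variable {n : ℕ} {G : Type*} [TopologicalSpace G] [ChartedSpace (EuclideanSpace ℝ (Fin n)) G]
  [Group G] {A : Type*} [CStarAlgebra A] [PartialOrder A] [StarOrderedRing A]
  {α : G →* (A ≃⋆ₐ[ℂ] A)} {φ : A →ₚ[ℂ] ℂ} {D E : Forms n (C1 n α) →ₗ[ℂ] Forms n A}

theorem graph_coreOp (h : ∀ p ∈ (formGraph φ D).topologicalClosure, p.1 = 0 → p.2 = 0) :
    (coreOp φ D).graph = formGraph φ D :=
  Submodule.toLinearPMap_graph_eq _ fun p hp => h p (Submodule.le_topologicalClosure _ hp)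

theorem coreOp_isClosable (h : ∀ p ∈ (formGraph φ D).topologicalClosure, p.1 = 0 → p.2 = 0) :
    (coreOp φ D).IsClosable :=
  isClosable_of_snd_eq_zero (by rwa [graph_coreOp h])

theorem snd_eq_zero_of_mem_closure_map {K : Hil n φ ≃L[ℂ] Hil n φ}
    (hK : ∀ x y, (x, y) ∈ formGraph φ D ↔ (K x, K y) ∈ formGraph φ E)
    (h : ∀ p ∈ (formGraph φ D).topologicalClosure, p.1 = 0 → p.2 = 0) :
    ∀ p ∈ (formGraph φ E).topologicalClosure, p.1 = 0 → p.2 = 0 := by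
  intro p hp h0
  have h1 := (mem_closure_iff_of_map hK (K.symm p.1) (K.symm p.2)).2 (by simpa using hp)
  simpa using h _ h1 (by simp [h0])

theorem Intertwines.coreOpDeg {K : Hil n φ ≃L[ℂ] Hil n φ}
    (h : Intertwines K (coreOp φ D) (coreOp φ E))
    (hdeg : ∀ k x, K x ∈ degreePart n φ k ↔ x ∈ degreePart n φ k) (k : ℕ) :
    Intertwines K (coreOpDeg φ D k) (coreOpDeg φ E k) := fun x y => by
  rw [mem_graph_coreOpDeg_iff, mem_graph_coreOpDeg_iff, hdeg, h]

variable {K : Hil n φ ≃L[ℂ] Hil n φ} (h : Intertwines K (coreOp φ D) (coreOp φ E))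
  (hdeg : ∀ k x, K x ∈ degreePart n φ k ↔ x ∈ degreePart n φ k) (hD : (coreOp φ D).IsClosable)

include h hdeg hD

theorem Intertwines.map_cocycles (k : ℕ) :
    (cocycles φ D k).map (K : Hil n φ →ₗ[ℂ] Hil n φ) = cocycles φ E k :=
  ((h.coreOpDeg hdeg k).closure (coreOpDeg_isClosable hD k)).map_opKer

theorem Intertwines.map_closedCoboundaries (k : ℕ) :
    (closedCoboundaries φ D k).map (K : Hil n φ →ₗ[ℂ] Hil n φ) = closedCoboundaries φ E k := by
  cases k with
  | zero => exact Submodule.map_bot _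
  | succ k => exact ((h.coreOpDeg hdeg k).closure (coreOpDeg_isClosable hD k)).map_closure_opRange

theorem Intertwines.exists_redCohom_equiv (k : ℕ) :
    ∃ e : RedCohom φ D k ≃ₗ[ℂ] RedCohom φ E k, ∀ (z : cocycles φ D k) (w : cocycles φ E k),
      (w : Hil n φ) = K z → e (Submodule.Quotient.mk z) = Submodule.Quotient.mk w := by
  let f : cocycles φ D k ≃ₗ[ℂ] cocycles φ E k :=
    K.toLinearEquiv.ofSubmodules _ _ (h.map_cocycles hdeg hD k)
  have hf : ∀ z, (f z : Hil n φ) = K z := fun z => rfl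
  have hmap : ((closedCoboundaries φ D k).submoduleOf (cocycles φ D k)).map (f : _ →ₗ[ℂ] _) =
      (closedCoboundaries φ E k).submoduleOf (cocycles φ E k) := by
    ext w
    obtain ⟨z, rfl⟩ := f.surjective w
    rw [Submodule.mem_map]
    have key : (K z : Hil n φ) ∈ closedCoboundaries φ E k ↔
        (z : Hil n φ) ∈ closedCoboundaries φ D k := by
      rw [← h.map_closedCoboundaries hdeg hD k]
      exact ⟨fun ⟨y, hy, e⟩ => K.injective e ▸ hy, fun hz => ⟨_, hz, rfl⟩⟩
    constructor
    · rintro ⟨y, hy, hyz⟩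
      obtain rfl : y = z := f.injective hyz
      exact key.2 hy
    · intro hz
      exact ⟨z, key.1 hz, rfl⟩
  refine ⟨Submodule.Quotient.equiv _ _ f hmap, fun z w hw => ?_⟩
  have : w = f z := Subtype.ext (hw.trans (hf z).symm)
  rw [this]
  rfl

end Transfer

end ConformalComplex

end

theorem mainTheorem7 {n : ℕ}
    {G : Type*} [TopologicalSpace G] [ChartedSpace (EuclideanSpace ℝ (Fin n)) G] [Group G]
    [LieGroup (𝓡 n) ∞ G] [CompactSpace G] [T2Space G]
    {A : Type*} [CStarAlgebra A] [PartialOrder A] [StarOrderedRing A]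
    (α : G →* (A ≃⋆ₐ[ℂ] A))
    (hcont : ∀ a : A, Continuous fun g : G => α g a)
    (hergodic : ∀ a : A, (∀ g : G, α g a = a) → ∃ c : ℂ, a = c • (1 : A))
    (φ : A →ₚ[ℂ] ℂ) (hφ_one : φ 1 = 1) (hφ_inv : ∀ (g : G) (a : A), φ (α g a) = φ a)
    (b : Module.Basis (Fin n) ℝ (GroupLieAlgebra (𝓡 n) G))
    (h : C1 n α) (hh : IsSelfAdjoint (h : A))
    (u : ℝ) (hu : u ∈ Set.Icc (0 : ℝ) 1) :
    -- `d` and `d_u` are well defined closable operators on the domain `C`, as are their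
    -- restrictions to forms of a given degree
    (∀ D ∈ ({extD α b, extDConf α b h u} :
          Set (Forms n (C1 n α) →ₗ[ℂ]
            Forms n A)),
      (coreOp φ D).graph = formGraph φ D ∧
      (coreOp φ D).IsClosable ∧
      ∀ k : ℕ,
        (coreOpDeg φ D k).IsClosable ∧
        closedCoboundaries φ D k ≤ cocycles φ D k) ∧
    -- the operator `K_u` on `ℋ`
    ∃ K : Hil n φ ≃L[ℂ] Hil n φ,
      (∀ η : Forms n A,
        K (cls n φ η) =
          cls n φ (confK n (h : A) u η)) ∧
      -- `K_u` carries `ker d` onto `ker d_u` and the closed range of `d` onto that of `d_u`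
      (opKer
          (coreOp φ (extD α b)).closure).map
            (K : Hil n φ →ₗ[ℂ] Hil n φ) =
        opKer
          (coreOp φ (extDConf α b h u)).closure ∧
      ((opRange
          (coreOp φ (extD α b)).closure).topologicalClosure).map
            (K : Hil n φ →ₗ[ℂ] Hil n φ) =
        (opRange
          (coreOp φ
            (extDConf α b h u)).closure).topologicalClosure ∧
      -- the same in each degree, and the induced isomorphism of reduced cohomology groups
      ∀ k : ℕ,
        (cocycles φ (extD α b) k).map
            (K : Hil n φ →ₗ[ℂ] Hil n φ) =
          cocycles φ (extDConf α b h u) k ∧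
        (closedCoboundaries φ (extD α b) k).map
            (K : Hil n φ →ₗ[ℂ] Hil n φ) =
          closedCoboundaries φ (extDConf α b h u) k ∧
        ∃ e : RedCohom φ (extD α b) k ≃ₗ[ℂ]
            RedCohom φ (extDConf α b h u) k,
          ∀ (z : cocycles φ (extD α b) k)
            (w : cocycles φ (extDConf α b h u) k),
            (w : Hil n φ) = K z →
              e (Submodule.Quotient.mk z) = Submodule.Quotient.mk w := by
  -- Only `d` needs an adjoint; the same property of `d_u` is transported through `K` in `hT`.
  have hS := fun p => snd_eq_zero_of_mem_closure_formGraph (α := α) hcont hφ_one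
    (extD_mem_adjointable hφ_inv b) p
  have htr := rsq_eq_lsq (n := n) hcont hergodic hφ_one hφ_inv
  have hK := mem_formGraph_extDConf_iff htr b h u
  have hT := snd_eq_zero_of_mem_closure_map hK hS
  set K := confKEquiv htr n (h : A) u with hKdef
  have hI : Intertwines K (coreOp φ (extD α b)) (coreOp φ (extDConf α b h u)) := by
    intro x y
    rw [graph_coreOp hS, graph_coreOp hT]
    exact hK x y
  have hdeg := confKEquiv_mem_degreePart_iff htr n (h : A) u
  have hcl := coreOp_isClosable hS
  have hle := closedCoboundaries_extD_le hcont hφ_one b (graph_coreOp hS) hcl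
  refine ⟨?_, K, confKEquiv_cls htr n (h : A) u, (hI.closure hcl).map_opKer,
    (hI.closure hcl).map_closure_opRange, fun k => ⟨hI.map_cocycles hdeg hcl k,
      hI.map_closedCoboundaries hdeg hcl k, hI.exists_redCohom_equiv hdeg hcl k⟩⟩
  rintro D (rfl | rfl)
  · exact ⟨graph_coreOp hS, hcl, fun k => ⟨coreOpDeg_isClosable hcl k, hle k⟩⟩
  · refine ⟨graph_coreOp hT, hI.isClosable hcl, fun k =>
      ⟨coreOpDeg_isClosable (hI.isClosable hcl) k, ?_⟩⟩
    -- Cocycles and closed coboundaries of `d_u` are the images under `K` of those of `d`, so the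
    -- inclusion for `d_u` follows from that for `d`.
    rw [← hI.map_cocycles hdeg hcl k, ← hI.map_closedCoboundaries hdeg hcl k]
    exact Submodule.map_mono (hle k)
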